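/- Let $k$ be a field of characteristic $0$ and let $H$ be a finite-dimensional Hopf algebra over $k$ with invertible antipode $S$. Write $\Delta(h)=h^1\otimes h^2$, $(\Delta\otimes \mathrm{id})\Delta(h)=h^1\otimes h^2\otimes h^3$, and $\rho(m)=m_0\otimes m_1$ for a right coaction. A right $H$-contramodule is a $k$-vector space $N$ with a $k$-linear map $\alpha:\mathrm{Hom}_k(H,N)\to N$ such that $\alpha(x\mapsto\alpha(h\mapsto f(x\otimes h)))=\alpha(h\mapsto f(h^1\otimes h^2))$ for all $f\in\mathrm{Hom}_k(H\otimes H,N)$ and $\alpha(h\mapsto\epsilon(h)n)=n$ for all $n\in N$. An anti-Yetter-Drinfeld (aYD) module is a left $H$-module and right $H$-comodule $M$ with $(hm)_0\otimes(hm)_1=h^2m_0\otimes h^3m_1S(h^1)$; it is stable (saYD) if $m_1m_0=m$ for all $m\in M$. An aYD-contramodule is a left $H$-module and right $H$-contramodule $N$ with $h\,\alpha(f)=\alpha\big(x\mapsto h^2f(S(h^3)\,x\,h^1)\big)$ for all $h\in H$, $f\in\mathrm{Hom}_k(H,N)$; it is stable (saYD) if $\alpha(h\mapsto hn)=n$ for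 all $n\in N$. Morphisms are the $k$-linear maps compatible with all the structures involved; stable objects form full subcategories. For a right $H$-comodule $M$ let $\widehat M=\mathrm{Hom}(H,M)^H$ be the space of morphisms of right comodules $H\to M$, with the contraaction $(\alpha\theta)(h)=\theta_{h^1}(h^2)$ for $\theta\in\mathrm{Hom}_k(H,\widehat M)$, $h\mapsto\theta_h$; on morphisms, $\widehat{g}(\phi)=g\circ\phi$. If $M$ is an aYD-module, let $\widehat M_H$ be $\widehat M$ with the left $H$-action $(h\cdot\phi)(x)=h^2\phi(S(h^3)\,x\,h^1)$. These are functors from comodules to contramodules, from aYD-modules to aYD-contramodules, and (by restriction) from saYD-modules to saYD-contramodules. Then the functor $M\mapsto\widehat M$ from right $H$-comodules to right $H$-contramodules is an equivalence of categories, the functor $M\mapsto\widehat M_H$ from aYD-modules to aYD-contramodules is an equivalence of categories, and so is its restriction from saYD-modules to saYD-contramodules. -/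

import Mathlib

open CategoryTheory TensorProduct Coalgebra WithConv
open scoped RingTheory.LinearMap

universe u v w

noncomputable section

namespace HopfCorr

section Calculus

variable {k : Type u} [Field k] {H : Type v} [Ring H] [HopfAlgebra k H]
variable {A : Type*} [Semiring A] [Algebra k A]

theorem conv_antipode_left (f : H →ₐ[k] A) :
    toConv (f.toLinearMap ∘ₗ HopfAlgebra.antipode k) * toConv f.toLinearMap = 1 := by
  have h := LinearMap.algHom_comp_convMul_distrib f
    (toConv (HopfAlgebra.antipode k (A := H))) (toConv LinearMap.id)
  rw [LinearMap.antipode_mul_id] at h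
  apply WithConv.ofConv_injective
  refine Eq.trans h.symm ?_
  ext x
  simp [LinearMap.convOne_def]

theorem conv_antipode_right (f : H →ₐ[k] A) :
    toConv f.toLinearMap * toConv (f.toLinearMap ∘ₗ HopfAlgebra.antipode k) = 1 := by
  have h := LinearMap.algHom_comp_convMul_distrib f
    (toConv LinearMap.id) (toConv (HopfAlgebra.antipode k (A := H)))
  rw [LinearMap.id_mul_antipode] at h
  apply WithConv.ofConv_injective
  refine Eq.trans h.symm ?_
  ext x
  simp [LinearMap.convOne_def]

theorem comul_antipode_repr {ι : Type*} {c : H} (r : Coalgebra.Repr k c ι) :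
    comul (R := k) (HopfAlgebra.antipode k c) =
      ∑ i ∈ r.index, HopfAlgebra.antipode k (r.right i) ⊗ₜ[k] HopfAlgebra.antipode k (r.left i) := by
  let i : H →ₐ[k] H ⊗[k] H := Algebra.TensorProduct.includeLeft
  let j : H →ₐ[k] H ⊗[k] H := Algebra.TensorProduct.includeRight
  let G : WithConv (H →ₗ[k] H ⊗[k] H) :=
    toConv (j.toLinearMap ∘ₗ HopfAlgebra.antipode k) *
      toConv (i.toLinearMap ∘ₗ HopfAlgebra.antipode k)
  have hδ : toConv (comul (R := k) (A := H)) = toConv i.toLinearMap * toConv j.toLinearMap := by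
    ext x
    rw [(ℛ k x).convMul_apply]
    simp [i, j, (ℛ k x).eq]
  have h1 : G * toConv (comul (R := k) (A := H)) = 1 := by
    rw [hδ]
    calc G * (toConv i.toLinearMap * toConv j.toLinearMap)
        = toConv (j.toLinearMap ∘ₗ HopfAlgebra.antipode k) *
          ((toConv (i.toLinearMap ∘ₗ HopfAlgebra.antipode k) * toConv i.toLinearMap) *
            toConv j.toLinearMap) := by simp only [G, mul_assoc]
      _ = 1 := by rw [conv_antipode_left, one_mul, conv_antipode_left]
  have h2 := left_inv_eq_right_inv h1 LinearMap.comul_right_inv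
  have h3 := congrArg (fun F : WithConv (H →ₗ[k] H ⊗[k] H) => F c) h2
  simp only [G] at h3
  rw [r.convMul_apply] at h3
  simpa [i, j] using h3.symm

end Calculus

/-! ### Comodules and contramodules over a coalgebra -/

/-- A right comodule over the `k`-coalgebra `C`. -/
structure Comod (k : Type u) [Field k] (C : Type v) [AddCommGroup C] [Module k C]
    [Coalgebra k C] where
  carrier : Type w
  [addCommGroup : AddCommGroup carrier]
  [module : Module k carrier]
  /-- the coaction `m ↦ m₀ ⊗ m₁` -/
  coact : carrier →ₗ[k] carrier ⊗[k] C
  coassoc : TensorProduct.assoc k carrier C C ∘ₗ coact.rTensor C ∘ₗ coact =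
    (comul (R := k) (A := C)).lTensor carrier ∘ₗ coact
  counit_coact : TensorProduct.rid k carrier ∘ₗ (counit (R := k) (A := C)).lTensor carrier ∘ₗ
    coact = LinearMap.id

/-- A right contramodule over the `k`-coalgebra `C`. -/
structure Contramod (k : Type u) [Field k] (C : Type v) [AddCommGroup C] [Module k C]
    [Coalgebra k C] where
  carrier : Type w
  [addCommGroup : AddCommGroup carrier]
  [module : Module k carrier]
  /-- the contraaction `α : Hom(C, N) → N` -/
  contra : (C →ₗ[k] carrier) →ₗ[k] carrier
  /-- `α(x ↦ α(y ↦ f(x ⊗ y))) = α(c ↦ f(c¹ ⊗ c²))` -/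
  contra_assoc : ∀ f : C ⊗[k] C →ₗ[k] carrier,
    contra (contra ∘ₗ TensorProduct.curry f) = contra (f ∘ₗ comul)
  /-- `α(c ↦ ε(c) n) = n` -/
  contra_counit : ∀ n : carrier, contra ((counit (R := k) (A := C)).smulRight n) = n

attribute [instance] Comod.addCommGroup Comod.module Contramod.addCommGroup Contramod.module

section Categories

variable {k : Type u} [Field k] {C : Type v} [AddCommGroup C] [Module k C] [Coalgebra k C]

/-- Morphisms of comodules: `k`-linear maps commuting with the coactions. -/
@[ext]
structure Comod.Hom (M N : Comod.{u, v, w} k C) where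
  lin : M.carrier →ₗ[k] N.carrier
  comm : N.coact ∘ₗ lin = lin.rTensor C ∘ₗ M.coact

/-- Morphisms of contramodules: `k`-linear maps commuting with the contraactions. -/
@[ext]
structure Contramod.Hom (M N : Contramod.{u, v, w} k C) where
  lin : M.carrier →ₗ[k] N.carrier
  comm : ∀ f : C →ₗ[k] M.carrier, lin (M.contra f) = N.contra (lin ∘ₗ f)

instance : Category (Comod.{u, v, w} k C) where
  Hom := Comod.Hom
  id M := ⟨LinearMap.id, by simp⟩
  comp f g := ⟨g.lin ∘ₗ f.lin, by
    rw [← LinearMap.comp_assoc, g.comm, LinearMap.comp_assoc, f.comm, LinearMap.rTensor_comp,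
      LinearMap.comp_assoc]⟩

instance : Category (Contramod.{u, v, w} k C) where
  Hom := Contramod.Hom
  id M := ⟨LinearMap.id, fun f => by simp⟩
  comp f g := ⟨g.lin ∘ₗ f.lin, fun x => by simp [f.comm, g.comm, LinearMap.comp_assoc]⟩

/-- `Hom(C, M)^C`: the `k`-linear maps `φ : C → M` that are morphisms of comodules. -/
def Comod.hatSubmodule (M : Comod.{u, v, w} k C) : Submodule k (C →ₗ[k] M.carrier) where
  carrier := {φ | M.coact ∘ₗ φ = φ.rTensor C ∘ₗ comul}
  zero_mem' := by simp
  add_mem' {f g} hf hg := by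
    simp only [Set.mem_ofPred_eq] at *
    simp [LinearMap.comp_add, LinearMap.rTensor_add, LinearMap.add_comp, hf, hg]
  smul_mem' r f hf := by
    simp only [Set.mem_ofPred_eq] at *
    simp [LinearMap.comp_smul, LinearMap.rTensor_smul, LinearMap.smul_comp, hf]

theorem Comod.mem_hatSubmodule {M : Comod.{u, v, w} k C} {φ : C →ₗ[k] M.carrier} :
    φ ∈ M.hatSubmodule ↔ M.coact ∘ₗ φ = φ.rTensor C ∘ₗ comul := Iff.rfl

/-- `θ ↦ (c ↦ θ_{c¹}(c²))` -/
def diagEval (k : Type u) [Field k] (C : Type v) [AddCommGroup C] [Module k C] [Coalgebra k C]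
    (M : Type w) [AddCommGroup M] [Module k M] :
    (C →ₗ[k] C →ₗ[k] M) →ₗ[k] (C →ₗ[k] M) :=
  LinearMap.lcomp k M (comul (R := k) (A := C)) ∘ₗ
    (TensorProduct.lift.equiv (.id k) C C M).toLinearMap

theorem diagEval_eq {M : Type w} [AddCommGroup M] [Module k M] (θ : C →ₗ[k] C →ₗ[k] M) :
    diagEval k C M θ = TensorProduct.lift θ ∘ₗ comul := rfl

theorem diagEval_repr {M : Type w} [AddCommGroup M] [Module k M] (θ : C →ₗ[k] C →ₗ[k] M)
    {ι : Type*} {c : C} (r : Coalgebra.Repr k c ι) :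
    diagEval k C M θ c = ∑ i ∈ r.index, θ (r.left i) (r.right i) := by
  simp [diagEval_eq, ← r.eq]

set_option linter.unusedSectionVars false in
theorem rTensor_lift_assoc_symm {M : Type w} [AddCommGroup M] [Module k M]
    (g : C →ₗ[k] C →ₗ[k] M) (a : C) (t : C ⊗[k] C) :
    (TensorProduct.lift g).rTensor C ((TensorProduct.assoc k C C C).symm (a ⊗ₜ t)) =
      (g a).rTensor C t := by
  induction t with
  | zero => simp
  | tmul x y => simp
  | add x y hx hy => simp [TensorProduct.tmul_add, hx, hy]

theorem Comod.diagEval_mem (M : Comod.{u, v, w} k C) (θ : C →ₗ[k] M.hatSubmodule) :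
    diagEval k C M.carrier (M.hatSubmodule.subtype ∘ₗ θ) ∈ M.hatSubmodule := by
  rw [Comod.mem_hatSubmodule, diagEval_eq, LinearMap.rTensor_comp, LinearMap.comp_assoc,
    ← Coalgebra.coassoc_symm, ← LinearMap.comp_assoc]
  have h : M.coact ∘ₗ TensorProduct.lift (M.hatSubmodule.subtype ∘ₗ θ) =
      (TensorProduct.lift (M.hatSubmodule.subtype ∘ₗ θ)).rTensor C ∘ₗ
        (TensorProduct.assoc k C C C).symm.toLinearMap ∘ₗ
          (comul (R := k) (A := C)).lTensor C := by
    refine TensorProduct.ext' fun a b => ?_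
    have hb := LinearMap.congr_fun (Comod.mem_hatSubmodule.mp (θ a).2) b
    simp only [LinearMap.comp_apply, TensorProduct.lift.tmul, LinearMap.lTensor_tmul,
      LinearEquiv.coe_coe, rTensor_lift_assoc_symm] at hb ⊢
    exact hb
  rw [h]
  rfl

/-- The contraaction on `Hom(C, M)^C`: `(α θ)(c) = θ_{c¹}(c²)`. -/
def Comod.hatContra (M : Comod.{u, v, w} k C) :
    (C →ₗ[k] M.hatSubmodule) →ₗ[k] M.hatSubmodule :=
  LinearMap.codRestrict M.hatSubmodule
    (diagEval k C M.carrier ∘ₗ LinearMap.compRight k M.hatSubmodule.subtype)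
    (fun θ => M.diagEval_mem θ)

theorem Comod.hatContra_coe (M : Comod.{u, v, w} k C) (θ : C →ₗ[k] M.hatSubmodule) :
    (M.hatContra θ : C →ₗ[k] M.carrier) =
      diagEval k C M.carrier (M.hatSubmodule.subtype ∘ₗ θ) := rfl

theorem lift_diagEval_curry {M : Type w} [AddCommGroup M] [Module k M]
    (f : C ⊗[k] C →ₗ[k] C →ₗ[k] M) :
    diagEval k C M (diagEval k C M ∘ₗ TensorProduct.curry f) = diagEval k C M (f ∘ₗ comul) := by
  have h1 : TensorProduct.lift (diagEval k C M ∘ₗ TensorProduct.curry f) =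
      TensorProduct.lift f ∘ₗ (TensorProduct.assoc k C C C).symm.toLinearMap ∘ₗ
        (comul (R := k) (A := C)).lTensor C := by
    refine TensorProduct.ext' fun a b => ?_
    simp only [TensorProduct.lift.tmul, LinearMap.comp_apply, LinearMap.lTensor_tmul,
      LinearEquiv.coe_coe, diagEval_eq]
    generalize (comul (R := k) b) = t
    induction t with
    | zero => simp
    | tmul x y => simp
    | add x y hx hy => simp [TensorProduct.tmul_add, hx, hy]
  have h2 : TensorProduct.lift (f ∘ₗ comul) =
      TensorProduct.lift f ∘ₗ (comul (R := k) (A := C)).rTensor C :=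
    TensorProduct.ext' fun a b => by simp
  rw [diagEval_eq, h1, diagEval_eq, h2, LinearMap.comp_assoc, LinearMap.comp_assoc,
    LinearMap.comp_assoc, Coalgebra.coassoc_symm]

/-- The contramodule `Hom(C, M)^C` attached to a comodule `M`. -/
def Comod.hatObj (M : Comod.{u, v, w} k C) : Contramod.{u, v, max v w} k C where
  carrier := M.hatSubmodule
  contra := M.hatContra
  contra_assoc f := by
    apply Subtype.ext
    exact lift_diagEval_curry (M.hatSubmodule.subtype ∘ₗ f)
  contra_counit n := by
    apply Subtype.ext
    refine LinearMap.ext fun c => ?_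
    rw [Comod.hatContra_coe, diagEval_repr _ (ℛ k c)]
    have := congrArg (n : C →ₗ[k] M.carrier) (Coalgebra.sum_counit_smul (ℛ k c))
    rw [map_sum] at this
    simpa using this

/-- Postcomposition with a morphism of comodules `g : M → N`. -/
def Comod.hatMapLin {M N : Comod.{u, v, w} k C} (g : M.Hom N) :
    M.hatSubmodule →ₗ[k] N.hatSubmodule :=
  LinearMap.restrict (LinearMap.compRight k g.lin) fun φ hφ => by
    rw [Comod.mem_hatSubmodule] at hφ ⊢
    change N.coact ∘ₗ (g.lin ∘ₗ φ) = (g.lin ∘ₗ φ).rTensor C ∘ₗ comul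
    rw [← LinearMap.comp_assoc, g.comm, LinearMap.comp_assoc, hφ, LinearMap.rTensor_comp,
      LinearMap.comp_assoc]

theorem Comod.hatMapLin_coe {M N : Comod.{u, v, w} k C} (g : M.Hom N) (φ : M.hatSubmodule) :
    (Comod.hatMapLin g φ : C →ₗ[k] N.carrier) = g.lin ∘ₗ (φ : C →ₗ[k] M.carrier) := rfl

def Comod.hatMap {M N : Comod.{u, v, w} k C} (g : M.Hom N) : M.hatObj.Hom N.hatObj where
  lin := Comod.hatMapLin g
  comm θ := by
    apply Subtype.ext
    change g.lin ∘ₗ (diagEval k C M.carrier (M.hatSubmodule.subtype ∘ₗ θ)) =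
      diagEval k C N.carrier (N.hatSubmodule.subtype ∘ₗ (Comod.hatMapLin g ∘ₗ θ))
    rw [diagEval_eq, diagEval_eq, ← LinearMap.comp_assoc]
    congr 1
    exact TensorProduct.ext' fun a b => rfl

/-- The functor `M ↦ Hom(C, M)^C` from right comodules to right contramodules. -/
def Comod.hat (k : Type u) [Field k] (C : Type v) [AddCommGroup C] [Module k C]
    [Coalgebra k C] : Comod.{u, v, w} k C ⥤ Contramod.{u, v, max v w} k C where
  obj M := M.hatObj
  map g := Comod.hatMap g

end Categories

/-! ### Anti-Yetter-Drinfeld modules and contramodules over a Hopf algebra -/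

section Hopf

variable {k : Type u} [Field k] {H : Type v} [Ring H] [HopfAlgebra k H]

section Twist

variable {M : Type w} [AddCommGroup M] [Module k M] (act : H →ₐ[k] Module.End k M)

/-- `a ↦ (f ↦ (x ↦ f(x a)))` -/
def preR (k : Type u) [Field k] (H : Type v) [Ring H] [HopfAlgebra k H]
    (M : Type w) [AddCommGroup M] [Module k M] : H →ₗ[k] Module.End k (H →ₗ[k] M) :=
  (LinearMap.llcomp k H H M).flip ∘ₗ (LinearMap.mul k H).flip

/-- `b ↦ (f ↦ (x ↦ b f(x)))` -/
def post : H →ₗ[k] Module.End k (H →ₗ[k] M) :=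
  LinearMap.llcomp k H M M ∘ₗ act.toLinearMap

/-- `c ↦ (f ↦ (x ↦ f(S(c) x)))` -/
def preL (k : Type u) [Field k] (H : Type v) [Ring H] [HopfAlgebra k H]
    (M : Type w) [AddCommGroup M] [Module k M] : H →ₗ[k] Module.End k (H →ₗ[k] M) :=
  (LinearMap.llcomp k H H M).flip ∘ₗ LinearMap.mul k H ∘ₗ HopfAlgebra.antipode k

@[simp] theorem preR_apply (a : H) (f : H →ₗ[k] M) (x : H) : preR k H M a f x = f (x * a) := rfl

@[simp] theorem post_apply (b : H) (f : H →ₗ[k] M) (x : H) : post act b f x = act b (f x) := rfl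

@[simp] theorem preL_apply (c : H) (f : H →ₗ[k] M) (x : H) :
    preL k H M c f x = f (HopfAlgebra.antipode k c * x) := rfl

/-- For a left `H`-module `M` and `h ∈ H`, the endomorphism `f ↦ h² f(S(h³) - h¹)`
of `Hom(H, M)`, written as the convolution product of the three maps
`a ↦ (f ↦ f(- a))`, `b ↦ (f ↦ b f(-))`, `c ↦ (f ↦ f(S(c) -))` from `H` to `End (Hom(H, M))`;
see `twist_repr` for the formula on elements. -/
def twist : H →ₗ[k] Module.End k (H →ₗ[k] M) :=
  (toConv (preR k H M) * (toConv (post act) * toConv (preL k H M))).ofConv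

/-- For a left `H`-module `M` and `h ∈ H`, the endomorphism `m ⊗ y ↦ h² m ⊗ h³ y S(h¹)`
of `M ⊗ H`, written as a convolution product; see `aydTwist_repr` for the formula on elements. -/
def aydTwist : H →ₗ[k] Module.End k (M ⊗[k] H) :=
  (toConv (LinearMap.lTensorHom M ∘ₗ (LinearMap.mul k H).flip ∘ₗ HopfAlgebra.antipode k) *
    (toConv (LinearMap.rTensorHom H ∘ₗ act.toLinearMap) *
      toConv (LinearMap.lTensorHom M ∘ₗ LinearMap.mul k H))).ofConv

theorem twist_repr {h : H} {ι κ : Type*} (r : Coalgebra.Repr k h ι)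
    (q : ∀ i, Coalgebra.Repr k (r.right i) κ) (f : H →ₗ[k] M) (x : H) :
    twist act h f x = ∑ i ∈ r.index, ∑ j ∈ (q i).index,
      act ((q i).left j) (f (HopfAlgebra.antipode k ((q i).right j) * (x * r.left i))) := by
  have h1 : twist act h = (toConv (preR k H M) * (toConv (post act) * toConv (preL k H M))) h := rfl
  rw [h1, r.convMul_apply]
  simp only [LinearMap.sum_apply, Module.End.mul_apply]
  refine Finset.sum_congr rfl fun i _ => ?_
  rw [(q i).convMul_apply]
  simp

theorem aydTwist_repr {h : H} {ι κ : Type*} (r : Coalgebra.Repr k h ι)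
    (q : ∀ i, Coalgebra.Repr k (r.right i) κ) (m : M) (y : H) :
    aydTwist act h (m ⊗ₜ y) = ∑ i ∈ r.index, ∑ j ∈ (q i).index,
      act ((q i).left j) m ⊗ₜ[k] ((q i).right j * y * HopfAlgebra.antipode k (r.left i)) := by
  have h1 : aydTwist act h =
    (toConv (LinearMap.lTensorHom M ∘ₗ (LinearMap.mul k H).flip ∘ₗ HopfAlgebra.antipode k) *
    (toConv (LinearMap.rTensorHom H ∘ₗ act.toLinearMap) *
      toConv (LinearMap.lTensorHom M ∘ₗ LinearMap.mul k H))) h := rfl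
  rw [h1, r.convMul_apply]
  simp only [LinearMap.sum_apply, Module.End.mul_apply]
  refine Finset.sum_congr rfl fun i _ => ?_
  rw [(q i).convMul_apply]
  simp

theorem twist_eq_conv (h : H) : twist act h =
    (toConv (preR k H M) * (toConv (post act) * toConv (preL k H M))) h := rfl

theorem twist_one : twist act 1 = 1 := by
  let r : Coalgebra.Repr k (1 : H) Unit := ⟨{()}, fun _ => 1, fun _ => 1, by
    simp [Algebra.TensorProduct.one_def]⟩
  ext f x
  rw [twist_repr act r (fun _ => r)]
  simp [r]

/-- representation of `Δ(g h)` -/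
def mulRepr {g h : H} {ι κ : Type*} (r : Coalgebra.Repr k g ι) (q : Coalgebra.Repr k h κ) :
    Coalgebra.Repr k (g * h) (ι × κ) where
  index := r.index ×ˢ q.index
  left p := r.left p.1 * q.left p.2
  right p := r.right p.1 * q.right p.2
  eq := by
    rw [Bialgebra.comul_mul, ← r.eq, ← q.eq, Finset.sum_mul_sum, Finset.sum_product]
    simp

theorem twist_mul (g h : H) : twist act (g * h) = twist act g * twist act h := by
  ext f x
  rw [Module.End.mul_apply, twist_repr act (ℛ k g) (fun i => ℛ k _),
    twist_repr act (mulRepr (ℛ k g) (ℛ k h)) (fun p => mulRepr (ℛ k _) (ℛ k _))]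
  simp_rw [twist_repr act (ℛ k h) (fun i => ℛ k _)]
  simp only [mulRepr, Finset.sum_product, map_sum]
  refine Finset.sum_congr rfl fun i _ => ?_
  rw [Finset.sum_comm]
  refine Finset.sum_congr rfl fun i _ => ?_
  refine Finset.sum_congr rfl fun i _ => ?_
  refine Finset.sum_congr rfl fun i _ => ?_
  simp [HopfAlgebra.antipode_mul_antidistrib, mul_assoc]

/-- Auxiliary evaluation map: `u ⊗ (d ⊗ e) ↦ (x ⊗ y ↦ (u φ)(x) ⊗ d y e)`. -/
def evAux (φ : H →ₗ[k] M) :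
    Module.End k (H →ₗ[k] M) ⊗[k] (H ⊗[k] H) →ₗ[k] (H ⊗[k] H →ₗ[k] M ⊗[k] H) :=
  TensorProduct.lift ((TensorProduct.mapBilinear (.id k) H H M H).compl₁₂
    (LinearMap.applyₗ φ)
    (TensorProduct.lift ((LinearMap.llcomp k H H H).compl₁₂ (LinearMap.mul k H)
      (LinearMap.mul k H).flip)))

theorem evAux_tmul (φ : H →ₗ[k] M) (u : Module.End k (H →ₗ[k] M)) (d e x y : H) :
    evAux φ (u ⊗ₜ (d ⊗ₜ e)) (x ⊗ₜ y) = (u φ x) ⊗ₜ[k] (d * (y * e)) := by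
  simp [evAux]

theorem evAux_one (φ : H →ₗ[k] M) (u : Module.End k (H →ₗ[k] M)) :
    evAux φ (u ⊗ₜ 1) = (u φ).rTensor H := by
  refine TensorProduct.ext' fun x y => ?_
  rw [Algebra.TensorProduct.one_def, evAux_tmul]
  simp

theorem conv_cancel {T : Type*} [Semiring T] [Algebra k T] (a b c : WithConv (H →ₗ[k] T))
    (D E : H →ₐ[k] T) :
    (a * toConv E.toLinearMap) *
      ((toConv (E.toLinearMap ∘ₗ HopfAlgebra.antipode k) * (b * toConv D.toLinearMap)) *
        (toConv (D.toLinearMap ∘ₗ HopfAlgebra.antipode k) * c)) = a * (b * c) := by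
  have hE := conv_antipode_right E
  have hD := conv_antipode_right D
  generalize toConv (E.toLinearMap ∘ₗ HopfAlgebra.antipode k) = eS at *
  generalize toConv (D.toLinearMap ∘ₗ HopfAlgebra.antipode k) = dS at *
  generalize toConv E.toLinearMap = e at *
  generalize toConv D.toLinearMap = d at *
  calc (a * e) * ((eS * (b * d)) * (dS * c))
      = a * ((e * eS) * (b * ((d * dS) * c))) := by simp only [mul_assoc]
    _ = a * (b * c) := by rw [hE, hD, one_mul, one_mul]

theorem algHom_twist {T : Type*} [Semiring T] [Algebra k T]
    (i : Module.End k (H →ₗ[k] M) →ₐ[k] T) (h : H) :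
    i (twist act h) = (toConv (i.toLinearMap ∘ₗ preR k H M) *
      (toConv (i.toLinearMap ∘ₗ post act) * toConv (i.toLinearMap ∘ₗ preL k H M))) h := by
  rw [twist_eq_conv, (ℛ k h).convMul_apply, (ℛ k h).convMul_apply, map_sum]
  refine Finset.sum_congr rfl fun j _ => ?_
  rw [(ℛ k ((ℛ k h).right j)).convMul_apply, (ℛ k ((ℛ k h).right j)).convMul_apply, map_mul,
    map_sum]
  simp

theorem twist_colinear (ρ : M →ₗ[k] M ⊗[k] H)
    (hρ : ∀ (h : H) (m : M), ρ (act h m) = aydTwist act h (ρ m))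
    (φ : H →ₗ[k] M) (hφ : ρ ∘ₗ φ = φ.rTensor H ∘ₗ comul) (h : H) :
    ρ ∘ₗ (twist act h φ) = (twist act h φ).rTensor H ∘ₗ comul := by
  obtain ⟨i, hi⟩ : ∃ i : Module.End k (H →ₗ[k] M) →ₐ[k]
      Module.End k (H →ₗ[k] M) ⊗[k] (H ⊗[k] H), ∀ u, i u = u ⊗ₜ 1 :=
    ⟨Algebra.TensorProduct.includeLeft, fun _ => rfl⟩
  obtain ⟨D, hD⟩ : ∃ D : H →ₐ[k] Module.End k (H →ₗ[k] M) ⊗[k] (H ⊗[k] H),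
      ∀ x, D x = 1 ⊗ₜ (x ⊗ₜ 1) :=
    ⟨Algebra.TensorProduct.includeRight.comp Algebra.TensorProduct.includeLeft, fun _ => rfl⟩
  obtain ⟨E, hE⟩ : ∃ E : H →ₐ[k] Module.End k (H →ₗ[k] M) ⊗[k] (H ⊗[k] H),
      ∀ x, E x = 1 ⊗ₜ (1 ⊗ₜ x) :=
    ⟨Algebra.TensorProduct.includeRight.comp Algebra.TensorProduct.includeRight, fun _ => rfl⟩
  have hterm : ∀ x1 x2 y1 y2 y3 z1 z2 t1 t2 : H,
      evAux φ (i (preR k H M x1) * E x2 * (E (HopfAlgebra.antipode k y1) *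
        (i (post act y2) * D y3) * (D (HopfAlgebra.antipode k z1) * i (preL k H M z2))))
          (t1 ⊗ₜ t2) =
      act y2 (φ (HopfAlgebra.antipode k z2 * t1 * x1)) ⊗ₜ[k]
        (y3 * (HopfAlgebra.antipode k z1 * t2 * x2) * HopfAlgebra.antipode k y1) := by
    intro x1 x2 y1 y2 y3 z1 z2 t1 t2
    simp only [hi, hD, hE, Algebra.TensorProduct.one_def, Algebra.TensorProduct.tmul_mul_tmul,
      one_mul, mul_one, evAux_tmul, Module.End.mul_apply, preR_apply, post_apply, preL_apply,
      mul_assoc]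
  have key : ∀ x y z t : H, ρ (act y (φ (HopfAlgebra.antipode k z * (t * x)))) =
      evAux φ ((toConv (i.toLinearMap ∘ₗ preR k H M) * toConv E.toLinearMap) x *
        ((toConv (E.toLinearMap ∘ₗ HopfAlgebra.antipode k) *
          (toConv (i.toLinearMap ∘ₗ post act) * toConv D.toLinearMap)) y *
        (toConv (D.toLinearMap ∘ₗ HopfAlgebra.antipode k) *
          toConv (i.toLinearMap ∘ₗ preL k H M)) z)) (comul t) := by
    intro x y z t
    have hφ' := LinearMap.congr_fun hφ (HopfAlgebra.antipode k z * (t * x))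
    simp only [LinearMap.comp_apply] at hφ'
    rw [hρ, hφ', Bialgebra.comul_mul, Bialgebra.comul_mul, comul_antipode_repr (ℛ k z),
      ← (ℛ k x).eq, ← (ℛ k t).eq, (ℛ k x).convMul_apply, (ℛ k y).convMul_apply,
      (ℛ k z).convMul_apply]
    have hbd : ∀ x : H, (toConv (i.toLinearMap ∘ₗ post act) * toConv D.toLinearMap) x =
        ∑ j ∈ (ℛ k x).index, i (post act ((ℛ k x).left j)) * D ((ℛ k x).right j) :=
      fun x => (ℛ k x).convMul_apply _ _
    simp only [hbd]
    simp only [map_sum, Finset.mul_sum, Finset.sum_mul, LinearMap.sum_apply,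
      Algebra.TensorProduct.tmul_mul_tmul, LinearMap.rTensor_tmul,
      aydTwist_repr act (ℛ k y) (fun i => ℛ k _), hterm,
      LinearMap.comp_apply, AlgHom.toLinearMap_apply]
    simp only [mul_assoc]
    rw [Finset.sum_comm]
    refine Finset.sum_congr rfl fun _ _ => ?_
    rw [Finset.sum_comm]
    refine Finset.sum_congr rfl fun _ _ => ?_
    rw [Finset.sum_comm]
    refine Finset.sum_congr rfl fun _ _ => ?_
    rw [Finset.sum_comm]
  refine LinearMap.ext fun t => ?_
  simp only [LinearMap.comp_apply]
  rw [twist_repr act (ℛ k h) (fun i => ℛ k _)]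
  simp only [map_sum, key]
  rw [← evAux_one, ← hi, algHom_twist, ← conv_cancel (toConv (i.toLinearMap ∘ₗ preR k H M)) _ _ D E, (ℛ k h).convMul_apply]
  simp only [map_sum, LinearMap.sum_apply]
  refine Finset.sum_congr rfl fun i _ => ?_
  rw [(ℛ k ((ℛ k h).right i)).convMul_apply]
  simp only [Finset.mul_sum, map_sum, LinearMap.sum_apply]

/-- The action of `H` on `Hom(H, M)` given by `h · f = h² f(S(h³) - h¹)`. -/
def twistAct : H →ₐ[k] Module.End k (H →ₗ[k] M) :=
  AlgHom.ofLinearMap (twist act) (twist_one act) (twist_mul act)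

theorem twistAct_apply (h : H) : twistAct act h = twist act h := rfl

theorem comp_twist {N : Type*} [AddCommGroup N] [Module k N] {act : H →ₐ[k] Module.End k M}
    {act' : H →ₐ[k] Module.End k N} (g : M →ₗ[k] N)
    (hg : ∀ (h : H) (m : M), g (act h m) = act' h (g m)) (h : H) (f : H →ₗ[k] M) :
    g ∘ₗ twist act h f = twist act' h (g ∘ₗ f) := by
  refine LinearMap.ext fun x => ?_
  rw [LinearMap.comp_apply, twist_repr act (ℛ k h) (fun i => ℛ k _),
    twist_repr act' (ℛ k h) (fun i => ℛ k _)]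
  simp [hg]

theorem lift_sum {ι : Type*} (s : Finset ι) (f : ι → H →ₗ[k] H →ₗ[k] M) :
    TensorProduct.lift (∑ i ∈ s, f i) = ∑ i ∈ s, TensorProduct.lift (f i) :=
  map_sum (TensorProduct.lift.equiv (.id k) H H M) f s

theorem twist_diagEval (θ : H →ₗ[k] H →ₗ[k] M) (h : H) :
    twist act h (diagEval k H M θ) = diagEval k H M (twist (twistAct act) h θ) := by
  obtain ⟨J, hJ⟩ : ∃ J : Module.End k (H →ₗ[k] M) →ₐ[k] Module.End k (H →ₗ[k] H →ₗ[k] M),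
      ∀ u f, J u f = u ∘ₗ f :=
    ⟨AlgHom.ofLinearMap (LinearMap.llcomp k H (H →ₗ[k] M) (H →ₗ[k] M)) rfl (fun _ _ => rfl),
      fun _ _ => rfl⟩
  have hpost : toConv (post (twistAct act)) = toConv (J.toLinearMap ∘ₗ preR k H M) *
      (toConv (J.toLinearMap ∘ₗ post act) * toConv (J.toLinearMap ∘ₗ preL k H M)) := by
    apply WithConv.ofConv_injective
    refine LinearMap.ext fun h => Eq.trans ?_ (algHom_twist act J h)
    exact LinearMap.ext fun f => (hJ _ _).symm
  have key : ∀ x y z t : H,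
      act y (diagEval k H M θ (HopfAlgebra.antipode k z * (t * x))) =
      TensorProduct.lift (((toConv (preR k H (H →ₗ[k] M)) *
        toConv (J.toLinearMap ∘ₗ preR k H M)) x * (J (post act y) *
        (toConv (J.toLinearMap ∘ₗ preL k H M) * toConv (preL k H (H →ₗ[k] M))) z)) θ)
        (comul t) := by
    intro x y z t
    rw [diagEval_eq, LinearMap.comp_apply, Bialgebra.comul_mul, Bialgebra.comul_mul,
      comul_antipode_repr (ℛ k z), ← (ℛ k x).eq, ← (ℛ k t).eq, (ℛ k x).convMul_apply,
      (ℛ k z).convMul_apply]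
    simp only [map_sum, Finset.mul_sum, Finset.sum_mul, LinearMap.sum_apply,
      Algebra.TensorProduct.tmul_mul_tmul, LinearMap.comp_apply, AlgHom.toLinearMap_apply,
      TensorProduct.lift.tmul, Module.End.mul_apply, hJ, preR_apply, preL_apply, post_apply]
    rw [Finset.sum_comm]
    refine Finset.sum_congr rfl fun _ _ => ?_
    rw [Finset.sum_comm]
  refine LinearMap.ext fun t => ?_
  rw [twist_repr act (ℛ k h) (fun i => ℛ k _)]
  simp only [key]
  have hconv : toConv (preR k H (H →ₗ[k] M)) *
      (toConv (post (twistAct act)) * toConv (preL k H (H →ₗ[k] M))) =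
      (toConv (preR k H (H →ₗ[k] M)) * toConv (J.toLinearMap ∘ₗ preR k H M)) *
        (toConv (J.toLinearMap ∘ₗ post act) *
          (toConv (J.toLinearMap ∘ₗ preL k H M) * toConv (preL k H (H →ₗ[k] M)))) := by
    rw [hpost]
    simp only [mul_assoc]
  rw [diagEval_eq, twist_eq_conv, hconv, (ℛ k h).convMul_apply]
  simp only [LinearMap.sum_apply, LinearMap.comp_apply]
  rw [lift_sum, LinearMap.sum_apply]
  refine Finset.sum_congr rfl fun i _ => ?_
  rw [(ℛ k ((ℛ k h).right i)).convMul_apply, Finset.mul_sum, LinearMap.sum_apply, lift_sum,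
    LinearMap.sum_apply]
  rfl

/-- Auxiliary evaluation map: `u ⊗ d ↦ (u φ)(d)`. -/
def evAux' (φ : H →ₗ[k] M) : Module.End k (H →ₗ[k] M) ⊗[k] H →ₗ[k] M :=
  TensorProduct.lift (LinearMap.applyₗ φ)

theorem evAux'_tmul (φ : H →ₗ[k] M) (u : Module.End k (H →ₗ[k] M)) (d : H) :
    evAux' φ (u ⊗ₜ d) = u φ d := rfl

theorem diagEval_twist_flip (φ : H →ₗ[k] M) (x : H) :
    diagEval k H M ((twist act).flip φ) x =
      TensorProduct.lift act.toLinearMap.flip (φ.rTensor H (comul x)) := by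
  obtain ⟨i, hi⟩ : ∃ i : Module.End k (H →ₗ[k] M) →ₐ[k]
      Module.End k (H →ₗ[k] M) ⊗[k] H, ∀ u, i u = u ⊗ₜ 1 :=
    ⟨Algebra.TensorProduct.includeLeft, fun _ => rfl⟩
  obtain ⟨D, hD⟩ : ∃ D : H →ₐ[k] Module.End k (H →ₗ[k] M) ⊗[k] H, ∀ x, D x = 1 ⊗ₜ x :=
    ⟨Algebra.TensorProduct.includeRight, fun _ => rfl⟩
  have key : ∀ y z : H, twist act y φ z = evAux' φ
      ((toConv (i.toLinearMap ∘ₗ preR k H M) * (toConv (i.toLinearMap ∘ₗ post act) *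
        toConv (D.toLinearMap ∘ₗ HopfAlgebra.antipode k))) y * D z) := by
    intro y z
    rw [twist_repr act (ℛ k y) (fun i => ℛ k _), (ℛ k y).convMul_apply]
    simp only [Finset.sum_mul, map_sum]
    refine Finset.sum_congr rfl fun j _ => ?_
    rw [(ℛ k ((ℛ k y).right j)).convMul_apply]
    simp only [Finset.mul_sum, Finset.sum_mul, map_sum, LinearMap.comp_apply,
      AlgHom.toLinearMap_apply, hi, hD, Algebra.TensorProduct.tmul_mul_tmul, one_mul, mul_one,
      evAux'_tmul, Module.End.mul_apply, preR_apply, post_apply, mul_assoc]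
  have hconv : toConv (i.toLinearMap ∘ₗ preR k H M) * (toConv (i.toLinearMap ∘ₗ post act) *
        toConv (D.toLinearMap ∘ₗ HopfAlgebra.antipode k)) * toConv D.toLinearMap =
      toConv (i.toLinearMap ∘ₗ preR k H M) * toConv (i.toLinearMap ∘ₗ post act) := by
    rw [mul_assoc, mul_assoc, conv_antipode_left, mul_one]
  rw [diagEval_repr _ (ℛ k x)]
  simp only [LinearMap.flip_apply, key]
  have h1 := (ℛ k x).convMul_apply (toConv (i.toLinearMap ∘ₗ preR k H M) *
    (toConv (i.toLinearMap ∘ₗ post act) *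
        toConv (D.toLinearMap ∘ₗ HopfAlgebra.antipode k))) (toConv D.toLinearMap)
  rw [hconv, (ℛ k x).convMul_apply] at h1
  have h2 := congrArg (evAux' φ) h1
  simp only [map_sum, LinearMap.comp_apply, AlgHom.toLinearMap_apply] at h2
  refine h2.symm.trans ?_
  rw [← (ℛ k x).eq, map_sum, map_sum]
  refine Finset.sum_congr rfl fun j _ => ?_
  simp only [hi, Algebra.TensorProduct.tmul_mul_tmul, one_mul, evAux'_tmul, Module.End.mul_apply,
    preR_apply, post_apply, LinearMap.rTensor_tmul, TensorProduct.lift.tmul, LinearMap.flip_apply,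
    AlgHom.toLinearMap_apply]

end Twist

variable (k H) in
/-- A left-right anti-Yetter-Drinfeld module: a left `H`-module and right `H`-comodule with
`(hm)₀ ⊗ (hm)₁ = h² m₀ ⊗ h³ m₁ S(h¹)`. The action is given as a morphism of `k`-algebras
`H → End_k(M)`. -/
structure AYDMod extends Comod.{u, v, w} k H where
  act : H →ₐ[k] Module.End k carrier
  compat : ∀ (h : H) (m : carrier), coact (act h m) = aydTwist act h (coact m)

variable (k H) in
/-- A left-right anti-Yetter-Drinfeld contramodule: a left `H`-module and right `H`-contramodule
with `h α(f) = α(h² f(S(h³) - h¹))`. -/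
structure AYDContramod extends Contramod.{u, v, w} k H where
  act : H →ₐ[k] Module.End k carrier
  compat : ∀ (h : H) (f : H →ₗ[k] carrier), act h (contra f) = contra (twist act h f)

/-- Morphisms of anti-Yetter-Drinfeld modules: `H`-linear morphisms of comodules. -/
@[ext]
structure AYDMod.Hom (M N : AYDMod.{u, v, w} k H) extends Comod.Hom M.toComod N.toComod where
  act_comm : ∀ (h : H) (m : M.carrier), lin (M.act h m) = N.act h (lin m)

/-- Morphisms of anti-Yetter-Drinfeld contramodules: `H`-linear morphisms of contramodules. -/
@[ext]
structure AYDContramod.Hom (M N : AYDContramod.{u, v, w} k H) extends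
    Contramod.Hom M.toContramod N.toContramod where
  act_comm : ∀ (h : H) (m : M.carrier), lin (M.act h m) = N.act h (lin m)

instance : Category (AYDMod.{u, v, w} k H) where
  Hom := AYDMod.Hom
  id M := ⟨𝟙 M.toComod, fun _ _ => rfl⟩
  comp {M N P} f g := ⟨CategoryStruct.comp (X := M.toComod) (Y := N.toComod) (Z := P.toComod)
    f.toHom g.toHom, fun h m => by
      change g.lin (f.lin _) = P.act h (g.lin (f.lin m))
      rw [f.act_comm, g.act_comm]⟩

instance : Category (AYDContramod.{u, v, w} k H) where
  Hom := AYDContramod.Hom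
  id M := ⟨𝟙 M.toContramod, fun _ _ => rfl⟩
  comp {M N P} f g := ⟨CategoryStruct.comp (X := M.toContramod) (Y := N.toContramod)
    (Z := P.toContramod) f.toHom g.toHom, fun h m => by
      change g.lin (f.lin _) = P.act h (g.lin (f.lin m))
      rw [f.act_comm, g.act_comm]⟩

/-- The action `h · φ = h² φ(S(h³) - h¹)` of `H` on `Hom(H, M)^H`. -/
def AYDMod.hatAct (M : AYDMod.{u, v, w} k H) : H →ₐ[k] Module.End k M.toComod.hatSubmodule :=
  AlgHom.ofLinearMap
    { toFun := fun h => LinearMap.restrict (twist M.act h)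
        fun φ hφ => twist_colinear M.act M.coact M.compat φ hφ h
      map_add' := fun g h => by ext φ x; simp; rfl
      map_smul' := fun r h => by ext φ x; simp; rfl }
    (by ext φ x; simp [twist_one])
    (fun g h => by ext φ x; simp [twist_mul]; rfl)

theorem AYDMod.hatAct_coe (M : AYDMod.{u, v, w} k H) (h : H) (φ : M.toComod.hatSubmodule) :
    (M.hatAct h φ : H →ₗ[k] M.carrier) = twist M.act h φ := rfl

theorem AYDMod.hatAct_compat (M : AYDMod.{u, v, w} k H) (h : H)
    (θ : H →ₗ[k] M.toComod.hatSubmodule) :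
    M.hatAct h (M.toComod.hatContra θ) = M.toComod.hatContra (twist M.hatAct h θ) := by
  apply Subtype.ext
  rw [AYDMod.hatAct_coe, Comod.hatContra_coe, Comod.hatContra_coe, twist_diagEval,
    comp_twist (act' := twistAct M.act) M.toComod.hatSubmodule.subtype (fun _ _ => rfl)]

/-- `Hom(H, M)^H` as an anti-Yetter-Drinfeld contramodule. -/
def AYDMod.hatObj (M : AYDMod.{u, v, w} k H) : AYDContramod.{u, v, max v w} k H where
  toContramod := M.toComod.hatObj
  act := M.hatAct
  compat := M.hatAct_compat

variable (k H) in
/-- The functor `M ↦ Hom(H, M)^H` from anti-Yetter-Drinfeld modules to anti-Yetter-Drinfeld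
contramodules. -/
def AYDMod.hat : AYDMod.{u, v, w} k H ⥤ AYDContramod.{u, v, max v w} k H where
  obj M := M.hatObj
  map {M N} g := ⟨Comod.hatMap g.toHom, fun h φ => by
    apply Subtype.ext
    exact comp_twist g.lin g.act_comm h _⟩

variable (k H) in
/-- Stability of an anti-Yetter-Drinfeld module: `m₁ m₀ = m`. -/
def AYDMod.isStable : ObjectProperty (AYDMod.{u, v, w} k H) := fun M =>
  ∀ m : M.carrier, TensorProduct.lift M.act.toLinearMap.flip (M.coact m) = m

variable (k H) in
/-- Stability of an anti-Yetter-Drinfeld contramodule: `α(h ↦ h n) = n`. -/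
def AYDContramod.isStable : ObjectProperty (AYDContramod.{u, v, w} k H) := fun N =>
  ∀ n : N.carrier, N.contra (N.act.toLinearMap.flip n) = n

variable (k H) in
/-- Stable anti-Yetter-Drinfeld modules, a full subcategory of `AYDMod k H`. -/
abbrev SAYDMod := (AYDMod.isStable.{u, v, w} k H).FullSubcategory

variable (k H) in
/-- Stable anti-Yetter-Drinfeld contramodules, a full subcategory of `AYDContramod k H`. -/
abbrev SAYDContramod := (AYDContramod.isStable.{u, v, w} k H).FullSubcategory

theorem AYDMod.isStable_hat (M : AYDMod.{u, v, w} k H) (hM : AYDMod.isStable k H M) :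
    AYDContramod.isStable k H ((AYDMod.hat k H).obj M) := by
  intro φ
  apply Subtype.ext
  refine LinearMap.ext fun x => ?_
  change diagEval k H M.carrier ((twist M.act).flip φ.1) x = φ.1 x
  rw [diagEval_twist_flip]
  have h := LinearMap.congr_fun (Comod.mem_hatSubmodule.mp φ.2) x
  simp only [LinearMap.comp_apply] at h
  rw [← h]
  exact hM _

variable (k H) in
/-- The restriction of `AYDMod.hat` to stable objects. -/
def SAYDMod.hat : SAYDMod.{u, v, w} k H ⥤ SAYDContramod.{u, v, max v w} k H :=
  (AYDContramod.isStable k H).lift ((AYDMod.isStable k H).ι ⋙ AYDMod.hat k H)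
    fun M => M.obj.isStable_hat M.property

end Hopf
end HopfCorr
end

/-! Everything rests on one element: a nonzero left integral `t` of `H`. It is a Frobenius element,
meaning that `f ↦ t¹ f(t²)` and `f ↦ f(t¹) t²` are bijections `H* → H`
(`exists_isFrobeniusElement`). Its existence comes from an explicit contraction `End(H) → H`,
following the Larson–Sweedler argument.

Over a finite-dimensional coalgebra `C`, comodules and contramodules are both left modules over the
convolution algebra `C*`, because a tensor in `V ⊗ C` is determined by its slices and `Hom(C, N)` is
spanned by rank one maps. Colinear maps `C → M` are then the `C*`-linear ones, and since `t` freely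
generates `C` over `C*`, evaluation at `t` identifies `Hom(C, M)^C` with `M`
(`IsFrobeniusElement.evalEquiv`). Under this identification the contramodule action of `f` becomes
the comodule action of `ν f`, where `ν` is the Nakayama automorphism
(`IsFrobeniusElement.evalEquiv_dualAct`). The functor is therefore restriction along an algebra
automorphism, hence an equivalence.

For the `H`-actions, consider evaluation `Hom(H, M)^H ⊗ H → M`. It is surjective, and it is
`H`-linear when the source carries the twisted action `h(n ⊗ x) = h² n ⊗ h³ x S(h¹)`
(`lift_aydTwist`). This makes the action on `M` recoverable from the one on the contramodule, which
gives fullness. Conversely, for an aYD-contramodule the twisted action descends along evaluation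
(`lift_aydTwist_contra`), the result is an aYD-module (`coact_lift_aydTwist`), and it induces the
original action (`sum_aydTwist`). Stability of `φ`, evaluated at `t`, is stability of `φ(t)`. -/

noncomputable section

namespace HopfCorr

/-! ### The two actions of the dual algebra on a coalgebra -/

section DualActions

variable {k : Type u} [Field k] {C : Type v} [AddCommGroup C] [Module k C] [Coalgebra k C]

/-- The convolution product of two functionals. -/
def dualMul (f g : Module.Dual k C) : Module.Dual k C := (toConv f * toConv g).ofConv

theorem dualMul_repr (f g : Module.Dual k C) {ι : Type*} {c : C} (r : Coalgebra.Repr k c ι) :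
    dualMul f g c = ∑ i ∈ r.index, f (r.left i) * g (r.right i) :=
  r.convMul_apply (toConv f) (toConv g)

theorem dualMul_assoc (f g h : Module.Dual k C) :
    dualMul (dualMul f g) h = dualMul f (dualMul g h) :=
  congrArg WithConv.ofConv (mul_assoc (toConv f) (toConv g) (toConv h))

theorem dualMul_counit (f : Module.Dual k C) : dualMul f (counit (R := k)) = f :=
  congrArg WithConv.ofConv (mul_one (toConv f))

theorem counit_dualMul (f : Module.Dual k C) : dualMul (counit (R := k)) f = f :=
  congrArg WithConv.ofConv (one_mul (toConv f))

/-- `f ↦ (c ↦ c¹ f(c²))` -/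
def hitL : Module.Dual k C →ₗ[k] Module.End k C where
  toFun f := (TensorProduct.rid k C).toLinearMap ∘ₗ f.lTensor C ∘ₗ comul
  map_add' f g := by ext; simp [LinearMap.lTensor_add]
  map_smul' r f := by ext; simp [LinearMap.lTensor_smul]

/-- `f ↦ (c ↦ f(c¹) c²)` -/
def hitR : Module.Dual k C →ₗ[k] Module.End k C where
  toFun f := (TensorProduct.lid k C).toLinearMap ∘ₗ f.rTensor C ∘ₗ comul
  map_add' f g := by ext; simp [LinearMap.rTensor_add]
  map_smul' r f := by ext; simp [LinearMap.rTensor_smul]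

theorem hitL_repr (f : Module.Dual k C) {ι : Type*} {c : C} (r : Coalgebra.Repr k c ι) :
    hitL f c = ∑ i ∈ r.index, f (r.right i) • r.left i := by
  simp [hitL, ← r.eq]

theorem hitR_repr (f : Module.Dual k C) {ι : Type*} {c : C} (r : Coalgebra.Repr k c ι) :
    hitR f c = ∑ i ∈ r.index, f (r.left i) • r.right i := by
  simp [hitR, ← r.eq]

/-- The left and right hit actions are the transposes of right and left multiplication in the dual
algebra. Since functionals separate points, the module laws below, and the commutation of the two
actions, reduce to associativity of convolution. -/
theorem apply_hitL (f g : Module.Dual k C) (c : C) : f (hitL g c) = dualMul f g c := by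
  rw [hitL_repr g (ℛ k c), dualMul_repr f g (ℛ k c), map_sum]
  simp [mul_comm]

theorem apply_hitR (f g : Module.Dual k C) (c : C) : g (hitR f c) = dualMul f g c := by
  rw [hitR_repr f (ℛ k c), dualMul_repr f g (ℛ k c), map_sum]
  simp

theorem eq_of_dual {V : Type*} [AddCommGroup V] [Module k V] {x y : V}
    (h : ∀ f : Module.Dual k V, f x = f y) : x = y := by
  rw [← sub_eq_zero, ← Module.forall_dual_apply_eq_zero_iff k]
  intro f
  rw [map_sub, h, sub_self]

theorem hitL_dualMul (f g : Module.Dual k C) (c : C) :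
    hitL (dualMul f g) c = hitL f (hitL g c) :=
  eq_of_dual fun h => by rw [apply_hitL, apply_hitL, apply_hitL, dualMul_assoc]

theorem hitR_dualMul (f g : Module.Dual k C) (c : C) :
    hitR (dualMul f g) c = hitR g (hitR f c) :=
  eq_of_dual fun h => by rw [apply_hitR, apply_hitR, apply_hitR, dualMul_assoc]

theorem hitL_hitR (f g : Module.Dual k C) (c : C) :
    hitL f (hitR g c) = hitR g (hitL f c) :=
  eq_of_dual fun h => by
    rw [apply_hitL, apply_hitR, apply_hitR, apply_hitL, dualMul_assoc]

theorem hitL_counit (c : C) : hitL (counit (R := k)) c = c :=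
  eq_of_dual fun h => by rw [apply_hitL, dualMul_counit]

theorem hitR_counit (c : C) : hitR (counit (R := k)) c = c :=
  eq_of_dual fun h => by rw [apply_hitR, counit_dualMul]

/-- Linear maps out of `Hom(V, X)`, with `V` finite-dimensional, are determined by their values
on the maps of rank one. -/
theorem hom_ext_smulRight {V X Y : Type*} [AddCommGroup V] [Module k V] [FiniteDimensional k V]
    [AddCommGroup X] [Module k X] [AddCommGroup Y] [Module k Y] {A B : (V →ₗ[k] X) →ₗ[k] Y}
    (h : ∀ (g : Module.Dual k V) (x : X), A (g.smulRight x) = B (g.smulRight x)) : A = B := by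
  refine LinearMap.ext fun F => ?_
  let b := Module.finBasis k V
  have hF : F = ∑ i, (b.coord i).smulRight (F (b i)) := by
    refine LinearMap.ext fun v => ?_
    conv_lhs => rw [← b.sum_repr v]
    simp only [map_sum, map_smul, LinearMap.sum_apply, LinearMap.smulRight_apply,
      Module.Basis.coord_apply]
  rw [hF, map_sum, map_sum]
  exact Finset.sum_congr rfl fun i _ => h _ _

/-- An element `t` of a coalgebra such that `f ↦ t¹ f(t²)` and `f ↦ f(t¹) t²` are bijections from
the dual space. -/
structure IsFrobeniusElement (k : Type u) [Field k] {C : Type v} [AddCommGroup C] [Module k C]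
    [Coalgebra k C] (t : C) : Prop where
  left : Function.Bijective fun f : Module.Dual k C => hitL f t
  right : Function.Bijective fun f : Module.Dual k C => hitR f t

/-- The dual has the same dimension, so injectivity gives bijectivity. The right map is the
transpose of the left one, `f(t¹ g(t²)) = g(f(t¹) t²)`; hence if it kills `f`, then `f` vanishes on
the image of the left map, which is everything. -/
theorem IsFrobeniusElement.of_injective [FiniteDimensional k C] {t : C}
    (h : ∀ f : Module.Dual k C, hitL f t = 0 → f = 0) : IsFrobeniusElement k t := by
  have key : ∀ A : Module.Dual k C →ₗ[k] C, (∀ f, A f = 0 → f = 0) → Function.Bijective A := by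
    intro A hA
    have hi : Function.Injective A := (injective_iff_map_eq_zero A).2 hA
    exact ⟨hi, (LinearMap.injective_iff_surjective_of_finrank_eq_finrank
      Subspace.dual_finrank_eq).1 hi⟩
  have hl := key (hitL.flip t) h
  refine ⟨hl, key (hitR.flip t) fun f hf => LinearMap.ext fun x => ?_⟩
  obtain ⟨g, rfl⟩ := hl.2 x
  change hitR f t = 0 at hf
  change f (hitL g t) = 0
  rw [apply_hitL, ← apply_hitR, hf, map_zero]

end DualActions

/-! ### Integrals in a finite-dimensional Hopf algebra -/

section Integral

variable {k : Type u} [Field k] {H : Type v} [Ring H] [HopfAlgebra k H]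

/-- The functional `x ↦ f(y x)`. -/
abbrev dualPreL (y : H) (f : Module.Dual k H) : Module.Dual k H := f ∘ₗ LinearMap.mulLeft k y

/-- The functional `x ↦ f(x y)`. -/
abbrev dualPreR (y : H) (f : Module.Dual k H) : Module.Dual k H := f ∘ₗ LinearMap.mulRight k y

/-- `x ⊗ y ↦ f(y) x` -/
def sliceL (f : Module.Dual k H) : H ⊗[k] H →ₗ[k] H :=
  (TensorProduct.rid k H).toLinearMap ∘ₗ f.lTensor H

theorem sliceL_tmul (f : Module.Dual k H) (x y : H) : sliceL f (x ⊗ₜ y) = f y • x := by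
  simp [sliceL]

theorem sliceL_comul (f : Module.Dual k H) (x : H) : sliceL f (comul x) = hitL f x := rfl

theorem sliceL_includeLeft_mul (f : Module.Dual k H) (a : H) (z : H ⊗[k] H) :
    sliceL f ((a ⊗ₜ 1) * z) = a * sliceL f z := by
  induction z with
  | zero => simp
  | tmul x y => simp [sliceL_tmul]
  | add x y hx hy => rw [mul_add, map_add, hx, hy, map_add, mul_add]

theorem sliceL_includeRight_mul (f : Module.Dual k H) (a : H) (z : H ⊗[k] H) :
    sliceL f ((1 ⊗ₜ a) * z) = sliceL (dualPreL a f) z := by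
  induction z with
  | zero => simp
  | tmul x y => simp [sliceL_tmul]
  | add x y hx hy => rw [mul_add, map_add, hx, hy, map_add]

theorem comul_eq_conv (k : Type u) [Field k] (H : Type v) [Ring H] [HopfAlgebra k H] :
    toConv (comul (R := k) (A := H)) =
      toConv (Algebra.TensorProduct.includeLeft : H →ₐ[k] H ⊗[k] H).toLinearMap *
        toConv (Algebra.TensorProduct.includeRight : H →ₐ[k] H ⊗[k] H).toLinearMap := by
  ext x
  rw [(ℛ k x).convMul_apply]
  simp [(ℛ k x).eq]

/-- The comultiplication is the convolution product of the two inclusions `H → H ⊗ H`, and composing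
the first one with the antipode gives its convolution inverse. -/
theorem sum_antipode_tmul_mul_comul {y : H} {ι : Type*} (r : Coalgebra.Repr k y ι) :
    ∑ i ∈ r.index, (HopfAlgebra.antipode k (r.left i) ⊗ₜ[k] (1 : H)) * comul (r.right i) =
      1 ⊗ₜ[k] y := by
  let i : H →ₐ[k] H ⊗[k] H := Algebra.TensorProduct.includeLeft
  let j : H →ₐ[k] H ⊗[k] H := Algebra.TensorProduct.includeRight
  have h : toConv (i.toLinearMap ∘ₗ HopfAlgebra.antipode k) * toConv (comul (R := k) (A := H)) =
      toConv j.toLinearMap := by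
    rw [comul_eq_conv, ← mul_assoc, conv_antipode_left, one_mul]
  have h2 := congrArg (fun F : WithConv (H →ₗ[k] H ⊗[k] H) => F y) h
  simp only at h2
  rwa [r.convMul_apply] at h2

/-- Write `1 ⊗ y = (S(y¹) ⊗ 1) Δ(y²)` and absorb `Δ(y²) Δ(t) = ε(y²) Δ(t)`. -/
theorem hitL_dualPreL_of_integral {t : H} (ht : ∀ h : H, h * t = counit (R := k) h • t)
    (y : H) (f : Module.Dual k H) :
    hitL (dualPreL y f) t = HopfAlgebra.antipode k y * hitL f t := by
  rw [← sliceL_comul, ← sliceL_includeRight_mul, ← sum_antipode_tmul_mul_comul (ℛ k y),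
    Finset.sum_mul, map_sum]
  simp only [mul_assoc, ← Bialgebra.comul_mul, ht, map_smul, sliceL_includeLeft_mul,
    sliceL_comul, mul_smul_comm]
  simp only [← smul_mul_assoc, ← map_smul, ← Finset.sum_mul, ← map_sum]
  rw [← hitL_repr _ (ℛ k y), hitL_counit]

variable [FiniteDimensional k H]

/-- The linear map with `F ↦ a¹ g(S(a²))` for `F = (x ↦ g(x) a)`. -/
def antipodeContract : (H →ₗ[k] H) →ₗ[k] H :=
  ∑ i, hitL ((Module.finBasis k H).coord i ∘ₗ HopfAlgebra.antipode k) ∘ₗ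
    LinearMap.applyₗ (Module.finBasis k H i)

theorem antipodeContract_apply (F : H →ₗ[k] H) : antipodeContract F =
    ∑ i, hitL ((Module.finBasis k H).coord i ∘ₗ HopfAlgebra.antipode k)
      (F (Module.finBasis k H i)) := by
  simp [antipodeContract]

theorem antipodeContract_smulRight (g : Module.Dual k H) (a : H) :
    antipodeContract (g.smulRight a) = hitL (g ∘ₗ HopfAlgebra.antipode k) a := by
  rw [antipodeContract_apply]
  have h := congrArg (hitL.flip a ∘ₗ LinearMap.lcomp k k (HopfAlgebra.antipode k))
    ((Module.finBasis k H).sum_dual_apply_smul_coord g)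
  rw [map_sum] at h
  simpa [LinearMap.lcomp_apply', LinearMap.smul_comp] using h

/-- For the rank one map `x ↦ g(x) a` the right side is `h¹ a¹ g(S(a²) S(h²) h³)`, and `S(h²) h³`
cancels. In the proof this becomes a cancellation in the convolution algebra of maps `H → H ⊗ H`. -/
theorem mul_antipodeContract {h : H} {ι : Type*} (r : Coalgebra.Repr k h ι) (F : H →ₗ[k] H) :
    h * antipodeContract F = ∑ i ∈ r.index, antipodeContract
      (LinearMap.mulLeft k (r.left i) ∘ₗ F ∘ₗ LinearMap.mulRight k (r.right i)) := by
  let I : H →ₐ[k] H ⊗[k] H := Algebra.TensorProduct.includeLeft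
  let J : H →ₐ[k] H ⊗[k] H := Algebra.TensorProduct.includeRight
  suffices hs : LinearMap.mulLeft k h ∘ₗ antipodeContract = ∑ i ∈ r.index, antipodeContract ∘ₗ
      LinearMap.compRight k (LinearMap.mulLeft k (r.left i)) ∘ₗ
        LinearMap.lcomp k H (LinearMap.mulRight k (r.right i)) by
    have := LinearMap.congr_fun hs F
    simpa [LinearMap.lcomp_apply'] using this
  refine hom_ext_smulRight fun g a => ?_
  let z : H ⊗[k] H := (HopfAlgebra.antipode k).lTensor H (comul a)
  let X : H →ₗ[k] H ⊗[k] H := LinearMap.mulRight k z ∘ₗ I.toLinearMap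
  have hz : ∀ (l y : H), sliceL g (I l * (z * J y)) =
      ∑ j ∈ (ℛ k a).index, g (HopfAlgebra.antipode k ((ℛ k a).right j) * y) •
        (l * (ℛ k a).left j) := by
    intro l y
    simp [z, I, J, ← (ℛ k a).eq, Finset.mul_sum, Finset.sum_mul, sliceL_tmul]
  have hterm : ∀ l y : H, antipodeContract (LinearMap.mulLeft k l ∘ₗ g.smulRight a ∘ₗ
      LinearMap.mulRight k y) =
        sliceL g ((toConv X * toConv (J.toLinearMap ∘ₗ HopfAlgebra.antipode k)) l * J y) := by
    intro l y
    have h1 : LinearMap.mulLeft k l ∘ₗ g.smulRight a ∘ₗ LinearMap.mulRight k y =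
        (dualPreR y g).smulRight (l * a) := by
      ext x; simp
    rw [h1, antipodeContract_smulRight, hitL_repr _ (mulRepr (ℛ k l) (ℛ k a)),
      (ℛ k l).convMul_apply, Finset.sum_mul, map_sum]
    simp only [mulRepr, Finset.sum_product]
    refine Finset.sum_congr rfl fun i _ => ?_
    have h2 : X ((ℛ k l).left i) * (J (HopfAlgebra.antipode k ((ℛ k l).right i))) * J y =
        I ((ℛ k l).left i) * (z * J (HopfAlgebra.antipode k ((ℛ k l).right i) * y)) := by
      simp only [X, LinearMap.comp_apply, LinearMap.mulRight_apply, AlgHom.toLinearMap_apply,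
        map_mul, mul_assoc]
    refine Eq.trans ?_ (congrArg (sliceL g) h2).symm
    rw [hz]
    simp [HopfAlgebra.antipode_mul_antidistrib, mul_assoc]
  simp only [LinearMap.comp_apply, LinearMap.sum_apply]
  have h3 : ∑ i ∈ r.index, (toConv X * toConv (J.toLinearMap ∘ₗ HopfAlgebra.antipode k))
      (r.left i) * J (r.right i) = X h := by
    have h4 := r.convMul_apply (toConv X * toConv (J.toLinearMap ∘ₗ HopfAlgebra.antipode k))
      (toConv J.toLinearMap)
    rw [mul_assoc, conv_antipode_left, mul_one] at h4
    exact h4.symm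
  refine Eq.trans ?_ (Finset.sum_congr rfl fun i _ => (hterm _ _).symm)
  rw [← map_sum, h3]
  change h * _ = sliceL g ((h ⊗ₜ 1) * z)
  rw [sliceL_includeLeft_mul, antipodeContract_smulRight]
  congr 1
  rw [hitL_repr _ (ℛ k a)]
  simp [z, ← (ℛ k a).eq, sliceL_tmul]

/-- `T(y ↦ S(y) x)` is a left integral. -/
theorem mul_antipodeContract_antipode (h x : H) :
    h * antipodeContract (LinearMap.mulRight k x ∘ₗ HopfAlgebra.antipode k) =
      counit (R := k) h •
        antipodeContract (LinearMap.mulRight k x ∘ₗ HopfAlgebra.antipode k) := by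
  rw [mul_antipodeContract (ℛ k h), ← map_sum, ← map_smul]
  congr 1
  ext y
  -- `h¹ S(y h²) x = h¹ S(h²) S(y) x = ε(h) S(y) x`.
  have h1 := HopfAlgebra.sum_mul_antipode_eq_algebraMap_counit (R := k) (ℛ k h)
  have h2 := congrArg (fun z => z * (HopfAlgebra.antipode k y * x)) h1
  simp only [Finset.sum_mul] at h2
  simp only [LinearMap.sum_apply, LinearMap.comp_apply, LinearMap.mulLeft_apply,
    LinearMap.mulRight_apply, HopfAlgebra.antipode_mul_antidistrib, LinearMap.smul_apply]
  simpa [mul_assoc, Algebra.algebraMap_eq_smul_one] using h2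

/-- For `F = (x ↦ g(x) a)` the sum over the dual bases collapses to `a¹ g(a² S(a³)) = g(1) a`.
Consequently the contraction cannot vanish on all maps `F(b -)` unless `F(1) = 0`. -/
theorem sum_hitL_antipodeContract (F : H →ₗ[k] H) :
    ∑ i, hitL ((Module.finBasis k H).coord i) (antipodeContract
      (F ∘ₗ LinearMap.mulLeft k (Module.finBasis k H i))) = F 1 := by
  set b := Module.finBasis k H
  suffices hs : ∑ i, hitL (b.coord i) ∘ₗ antipodeContract ∘ₗ
      LinearMap.lcomp k H (LinearMap.mulLeft k (b i)) = LinearMap.applyₗ (1 : H) by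
    have := LinearMap.congr_fun hs F
    simpa [LinearMap.lcomp_apply'] using this
  refine hom_ext_smulRight fun g a => ?_
  have h1 : ∀ i, (LinearMap.lcomp k H (LinearMap.mulLeft k (b i))) (g.smulRight a) =
      (dualPreL (b i) g).smulRight a := fun i => rfl
  have h2 : ∑ i, dualMul (b.coord i) (dualPreL (b i) g ∘ₗ HopfAlgebra.antipode k) =
      g 1 • (counit (R := k) (A := H)) := by
    refine LinearMap.ext fun x => ?_
    rw [LinearMap.sum_apply]
    simp only [dualMul_repr _ _ (ℛ k x)]
    rw [Finset.sum_comm]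
    have h3 : ∀ y z : H, ∑ i, b.coord i y * (dualPreL (b i) g ∘ₗ HopfAlgebra.antipode k) z =
        g (y * HopfAlgebra.antipode k z) := by
      intro y z
      conv_rhs => rw [← b.sum_repr y]
      simp only [LinearMap.comp_apply, Module.Basis.coord_apply, LinearMap.mulLeft_apply,
        Finset.sum_mul, map_sum, smul_mul_assoc, map_smul, smul_eq_mul]
    simp only [h3]
    rw [← map_sum, HopfAlgebra.sum_mul_antipode_eq_algebraMap_counit]
    simp [Algebra.algebraMap_eq_smul_one, mul_comm]
  simp only [LinearMap.sum_apply, LinearMap.comp_apply, h1, antipodeContract_smulRight,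
    ← hitL_dualMul]
  simp only [← LinearMap.sum_apply, ← map_sum]
  rw [h2, map_smul, LinearMap.smul_apply, hitL_counit]
  simp

/-- Here the dual bases collapse to `x¹ f(S(x²) x³) = f(1) x`. -/
theorem antipodeContract_hitL (f : Module.Dual k H) (x : H) {F : H →ₗ[k] H}
    (hF : ∀ y, F y = hitL (dualPreL y f) x) : antipodeContract F = f 1 • x := by
  rw [antipodeContract_apply]
  set b := Module.finBasis k H
  have h2 : ∑ i, dualMul (b.coord i ∘ₗ HopfAlgebra.antipode k) (dualPreL (b i) f) =
      f 1 • (counit (R := k) (A := H)) := by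
    refine LinearMap.ext fun x => ?_
    rw [LinearMap.sum_apply]
    simp only [dualMul_repr _ _ (ℛ k x)]
    rw [Finset.sum_comm]
    have h3 : ∀ y z : H, ∑ i, (b.coord i ∘ₗ HopfAlgebra.antipode k) y * dualPreL (b i) f z =
        f (HopfAlgebra.antipode k y * z) := by
      intro y z
      conv_rhs => rw [← b.sum_repr (HopfAlgebra.antipode k y)]
      simp only [LinearMap.comp_apply, Module.Basis.coord_apply, LinearMap.mulLeft_apply,
        Finset.sum_mul, map_sum, smul_mul_assoc, map_smul, smul_eq_mul]
    simp only [h3]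
    rw [← map_sum, HopfAlgebra.sum_antipode_mul_eq_algebraMap_counit]
    simp [Algebra.algebraMap_eq_smul_one, mul_comm]
  simp only [hF, ← hitL_dualMul]
  simp only [← LinearMap.sum_apply, ← map_sum]
  rw [h2, map_smul, LinearMap.smul_apply, hitL_counit]

-- The contractions of the maps `y ↦ S(y) x` are integrals. If all of them were zero,
-- `sum_hitL_antipodeContract` applied to the antipode would give `S(1) = 0`, because `S(b y) = S(y)
-- S(b)` keeps every summand in this family.
variable (k H) in
theorem exists_integral_ne_zero :
    ∃ t : H, t ≠ 0 ∧ ∀ h : H, h * t = counit (R := k) h • t := by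
  by_contra! hc
  have h0 : ∀ x : H,
      antipodeContract (LinearMap.mulRight k x ∘ₗ HopfAlgebra.antipode k) = 0 := by
    intro x
    by_contra hx
    obtain ⟨h, hh⟩ := hc _ hx
    exact hh (mul_antipodeContract_antipode h x)
  have h1 := sum_hitL_antipodeContract
    (LinearMap.mulRight k (1 : H) ∘ₗ HopfAlgebra.antipode k (A := H))
  have h2 : ∀ y : H, LinearMap.mulRight k (1 : H) ∘ₗ HopfAlgebra.antipode k (A := H) ∘ₗ
      LinearMap.mulLeft k y =
        LinearMap.mulRight k (HopfAlgebra.antipode k y) ∘ₗ HopfAlgebra.antipode k := by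
    intro y
    ext z
    simp [HopfAlgebra.antipode_mul_antidistrib]
  simp only [LinearMap.comp_assoc, h2, h0, map_zero, Finset.sum_const_zero] at h1
  have h3 := congrArg (counit (R := k) (A := H)) h1
  simp at h3

variable (k H) in
/-- A finite-dimensional Hopf algebra has a Frobenius element: a nonzero left integral. -/
theorem exists_isFrobeniusElement : ∃ t : H, IsFrobeniusElement k t := by
  obtain ⟨t, ht0, ht⟩ := exists_integral_ne_zero k H
  refine ⟨t, IsFrobeniusElement.of_injective fun f hf => ?_⟩
  -- As `t` is an integral, `t¹ g(y t²) = S(y) t¹ g(t²) = 0` for all `y`, so the contraction `g(1)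
  -- t` of the zero map is zero. Applying this to every translate `f(y -)` gives `f = 0`.
  have h1 : ∀ g : Module.Dual k H, hitL g t = 0 → g 1 = 0 := by
    intro g hg
    have h3 := antipodeContract_hitL g t (F := 0) fun y => by
      rw [hitL_dualPreL_of_integral ht, hg, mul_zero, LinearMap.zero_apply]
    rw [map_zero] at h3
    exact (smul_eq_zero.1 h3.symm).resolve_right ht0
  refine LinearMap.ext fun y => ?_
  have h4 := h1 (dualPreL y f) (by rw [hitL_dualPreL_of_integral ht, hf, mul_zero])
  simpa using h4

end Integral

/-! ### Slicing tensors by functionals, and coactions built from actions of the dual space -/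

section Slice

variable {k : Type u} [Field k] {C : Type v} [AddCommGroup C] [Module k C]

/-- `f ↦ (v ⊗ c ↦ f(c) v)` -/
def slice (V : Type*) [AddCommGroup V] [Module k V] :
    Module.Dual k C →ₗ[k] V ⊗[k] C →ₗ[k] V :=
  (LinearMap.llcomp k (V ⊗[k] C) (V ⊗[k] k) V (TensorProduct.rid k V).toLinearMap) ∘ₗ
    LinearMap.lTensorHom V

theorem slice_tmul {V : Type*} [AddCommGroup V] [Module k V] (f : Module.Dual k C) (v : V)
    (c : C) : slice V f (v ⊗ₜ c) = f c • v := by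
  simp [slice]

theorem slice_rTensor {V W : Type*} [AddCommGroup V] [Module k V] [AddCommGroup W] [Module k W]
    (f : Module.Dual k C) (g : V →ₗ[k] W) (z : V ⊗[k] C) :
    slice W f (g.rTensor C z) = g (slice V f z) := by
  induction z with
  | zero => simp
  | tmul x y => simp [slice_tmul]
  | add x y hx hy => simp only [map_add, hx, hy]

theorem sum_slice_tmul [FiniteDimensional k C] {V : Type*} [AddCommGroup V] [Module k V]
    (z : V ⊗[k] C) :
    ∑ i, slice V ((Module.finBasis k C).coord i) z ⊗ₜ Module.finBasis k C i = z := by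
  induction z with
  | zero => simp
  | tmul x y =>
    simp only [slice_tmul, TensorProduct.smul_tmul, ← TensorProduct.tmul_sum,
      Module.Basis.coord_apply, Module.Basis.sum_repr]
  | add x y hx hy => simp only [map_add, TensorProduct.add_tmul, Finset.sum_add_distrib, hx, hy]

/-- A tensor is rebuilt from its slices along a dual basis, so identities between coactions can be
tested as identities between actions of the dual algebra. -/
theorem eq_of_slice [FiniteDimensional k C] {V : Type*} [AddCommGroup V] [Module k V]
    {x y : V ⊗[k] C} (h : ∀ f, slice V f x = slice V f y) : x = y := by
  rw [← sum_slice_tmul x, ← sum_slice_tmul y]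
  simp only [h]

/-- `v ⊗ (c ⊗ d) ↦ f(c) g(d) v` -/
def slice₂ (V : Type*) [AddCommGroup V] [Module k V] (f g : Module.Dual k C) :
    V ⊗[k] (C ⊗[k] C) →ₗ[k] V :=
  (TensorProduct.rid k V).toLinearMap ∘ₗ
    (LinearMap.mul' k k ∘ₗ TensorProduct.map f g).lTensor V

theorem slice₂_tmul {V : Type*} [AddCommGroup V] [Module k V] (f g : Module.Dual k C) (v : V)
    (c d : C) : slice₂ V f g (v ⊗ₜ (c ⊗ₜ d)) = (f c * g d) • v := by
  simp [slice₂]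

theorem slice₂_assoc {V : Type*} [AddCommGroup V] [Module k V] (f g : Module.Dual k C)
    (z : (V ⊗[k] C) ⊗[k] C) :
    slice₂ V f g (TensorProduct.assoc k V C C z) = slice V f (slice (V ⊗[k] C) g z) := by
  induction z with
  | zero => simp
  | tmul x d =>
    induction x with
    | zero => simp
    | tmul v c => simp [slice₂_tmul, slice_tmul, smul_smul, mul_comm]
    | add x y hx hy => simp only [TensorProduct.add_tmul, map_add, hx, hy]
  | add x y hx hy => simp only [map_add, hx, hy]

theorem eq_of_slice₂ [FiniteDimensional k C] {V : Type*} [AddCommGroup V] [Module k V]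
    {x y : V ⊗[k] (C ⊗[k] C)} (h : ∀ f g, slice₂ V f g x = slice₂ V f g y) : x = y := by
  obtain ⟨x, rfl⟩ := (TensorProduct.assoc k V C C).surjective x
  obtain ⟨y, rfl⟩ := (TensorProduct.assoc k V C C).surjective y
  simp only [slice₂_assoc] at h
  exact congrArg _ (eq_of_slice fun g => eq_of_slice fun f => h f g)

/-- The coaction on `N` with `f(n₁) n₀ = D f n`. -/
def dualCoact [FiniteDimensional k C] {N : Type w} [AddCommGroup N] [Module k N]
    (D : Module.Dual k C →ₗ[k] Module.End k N) : N →ₗ[k] N ⊗[k] C :=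
  ∑ i, (TensorProduct.mk k N C).flip (Module.finBasis k C i) ∘ₗ D ((Module.finBasis k C).coord i)

theorem slice_dualCoact [FiniteDimensional k C] {N : Type w} [AddCommGroup N] [Module k N]
    (D : Module.Dual k C →ₗ[k] Module.End k N) (f : Module.Dual k C) (n : N) :
    slice N f (dualCoact D n) = D f n := by
  conv_rhs => rw [← (Module.finBasis k C).sum_dual_apply_smul_coord f]
  simp only [dualCoact, LinearMap.sum_apply, LinearMap.comp_apply, LinearMap.flip_apply,
    TensorProduct.mk_apply, map_sum, slice_tmul, map_smul, LinearMap.smul_apply]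

end Slice

/-! ### Comodules and contramodules over a coalgebra with a Frobenius element -/

section Frobenius

variable {k : Type u} [Field k] {C : Type v} [AddCommGroup C] [Module k C] [Coalgebra k C]

/-- The action `f · m = f(m₁) m₀` of the dual space on a comodule. -/
def Comod.dualAct (M : Comod.{u, v, w} k C) : Module.Dual k C →ₗ[k] Module.End k M.carrier :=
  (LinearMap.lcomp k M.carrier M.coact) ∘ₗ slice M.carrier

theorem Comod.dualAct_apply (M : Comod.{u, v, w} k C) (f : Module.Dual k C) (m : M.carrier) :
    M.dualAct f m = slice M.carrier f (M.coact m) := rfl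

theorem slice₂_lTensor_comul {V : Type*} [AddCommGroup V] [Module k V] (f g : Module.Dual k C)
    (z : V ⊗[k] C) :
    slice₂ V f g ((comul (R := k) (A := C)).lTensor V z) = slice V (dualMul f g) z := by
  induction z with
  | zero => simp
  | tmul x y => simp [slice₂, slice_tmul, dualMul]
  | add x y hx hy => simp only [map_add, hx, hy]

theorem Comod.dualAct_dualMul (M : Comod.{u, v, w} k C) (f g : Module.Dual k C)
    (m : M.carrier) : M.dualAct (dualMul f g) m = M.dualAct f (M.dualAct g m) := by
  have h := congrArg (slice₂ M.carrier f g) (LinearMap.congr_fun M.coassoc m)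
  simp only [LinearMap.comp_apply, slice₂_lTensor_comul, LinearEquiv.coe_coe, slice₂_assoc,
    slice_rTensor] at h
  exact h.symm

theorem Comod.Hom.lin_dualAct {M N : Comod.{u, v, w} k C} (g : M.Hom N) (f : Module.Dual k C)
    (m : M.carrier) : g.lin (M.dualAct f m) = N.dualAct f (g.lin m) := by
  have h := congrArg (slice N.carrier f) (LinearMap.congr_fun g.comm m)
  simp only [LinearMap.comp_apply, slice_rTensor] at h
  exact h.symm

/-- A linear map commuting with the actions of the dual space is a morphism of comodules. -/
def Comod.Hom.ofDualAct [FiniteDimensional k C] {M N : Comod.{u, v, w} k C}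
    (g : M.carrier →ₗ[k] N.carrier)
    (h : ∀ f m, g (M.dualAct f m) = N.dualAct f (g m)) : M.Hom N where
  lin := g
  comm := LinearMap.ext fun m => eq_of_slice fun f => by
    simp only [LinearMap.comp_apply, slice_rTensor]
    exact (h f m).symm

/-- Slicing the colinearity equation turns it into linearity over the dual algebra, with `C` a
module through `hitL`. -/
theorem Comod.mem_hatSubmodule_iff [FiniteDimensional k C] {M : Comod.{u, v, w} k C}
    {φ : C →ₗ[k] M.carrier} :
    φ ∈ M.hatSubmodule ↔ ∀ f c, M.dualAct f (φ c) = φ (hitL f c) := by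
  rw [Comod.mem_hatSubmodule]
  constructor
  · intro h f c
    have h1 := congrArg (slice M.carrier f) (LinearMap.congr_fun h c)
    simp only [LinearMap.comp_apply, slice_rTensor] at h1
    exact h1
  · intro h
    refine LinearMap.ext fun c => eq_of_slice fun f => ?_
    simp only [LinearMap.comp_apply, slice_rTensor]
    exact h f c

/-- The comodule attached to a representation of the convolution algebra of functionals. -/
def Comod.ofDualAct [FiniteDimensional k C] {N : Type w} [AddCommGroup N] [Module k N]
    (D : Module.Dual k C →ₗ[k] Module.End k N)
    (hmul : ∀ f g n, D (dualMul f g) n = D f (D g n))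
    (hone : ∀ n, D (counit (R := k)) n = n) : Comod.{u, v, w} k C where
  carrier := N
  coact := dualCoact D
  coassoc := LinearMap.ext fun n => eq_of_slice₂ fun f g => by
    simp only [LinearMap.comp_apply, slice₂_lTensor_comul, LinearEquiv.coe_coe, slice₂_assoc,
      slice_rTensor, slice_dualCoact, hmul]
  counit_coact := LinearMap.ext fun n => (slice_dualCoact D _ n).trans (hone n)

/-- The action `f · n = α(c ↦ f(c) n)` of the dual space on a contramodule. -/
def Contramod.dualAct (N : Contramod.{u, v, w} k C) :
    Module.Dual k C →ₗ[k] Module.End k N.carrier :=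
  LinearMap.llcomp k N.carrier (C →ₗ[k] N.carrier) N.carrier N.contra ∘ₗ
    LinearMap.smulRightₗ

theorem Contramod.dualAct_apply (N : Contramod.{u, v, w} k C) (f : Module.Dual k C)
    (n : N.carrier) : N.dualAct f n = N.contra (f.smulRight n) := rfl

theorem Contramod.dualAct_dualMul (N : Contramod.{u, v, w} k C) (f g : Module.Dual k C)
    (n : N.carrier) : N.dualAct (dualMul f g) n = N.dualAct f (N.dualAct g n) := by
  have h := N.contra_assoc ((LinearMap.mul' k k ∘ₗ TensorProduct.map f g).smulRight n)
  have h1 : N.contra ∘ₗ TensorProduct.curry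
      ((LinearMap.mul' k k ∘ₗ TensorProduct.map f g).smulRight n) =
      f.smulRight (N.dualAct g n) := by
    refine LinearMap.ext fun c => ?_
    rw [LinearMap.comp_apply, LinearMap.smulRight_apply, Contramod.dualAct_apply, ← map_smul]
    congr 1
    ext d
    simp [mul_smul]
  rw [h1] at h
  exact h.symm

theorem Contramod.dualAct_counit (N : Contramod.{u, v, w} k C) (n : N.carrier) :
    N.dualAct (counit (R := k)) n = n := N.contra_counit n

theorem Contramod.Hom.lin_dualAct {M N : Contramod.{u, v, w} k C} (g : M.Hom N)
    (f : Module.Dual k C) (m : M.carrier) : g.lin (M.dualAct f m) = N.dualAct f (g.lin m) := by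
  rw [Contramod.dualAct_apply, g.comm, Contramod.dualAct_apply]
  congr 1
  ext c
  simp

/-- On rank one maps the contraaction is the action of the dual space, and these maps span `Hom(C,
M)`. -/
theorem Contramod.lin_contra_of_dualAct [FiniteDimensional k C] {M N : Contramod.{u, v, w} k C}
    (g : M.carrier →ₗ[k] N.carrier) (h : ∀ f m, g (M.dualAct f m) = N.dualAct f (g m))
    (θ : C →ₗ[k] M.carrier) : g (M.contra θ) = N.contra (g ∘ₗ θ) := by
  suffices hs : g ∘ₗ M.contra = N.contra ∘ₗ LinearMap.compRight k g from LinearMap.congr_fun hs θ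
  refine hom_ext_smulRight fun f m => (h f m).trans ?_
  rw [Contramod.dualAct_apply, LinearMap.comp_apply]
  congr 1
  ext c
  simp

theorem Comod.hatObj_dualAct (M : Comod.{u, v, w} k C) (f : Module.Dual k C)
    (φ : M.hatSubmodule) (c : C) :
    (M.hatObj.dualAct f φ : M.hatSubmodule).1 c = φ.1 (hitR f c) := by
  change (M.hatContra (f.smulRight φ)).1 c = _
  rw [Comod.hatContra_coe, diagEval_repr _ (ℛ k c), hitR_repr _ (ℛ k c), map_sum]
  simp

/-- An isomorphism of contramodules from a linear equivalence. -/
def Contramod.isoOfEquiv {M N : Contramod.{u, v, w} k C} (e : M.carrier ≃ₗ[k] N.carrier)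
    (h : ∀ f : C →ₗ[k] M.carrier, e (M.contra f) = N.contra (e.toLinearMap ∘ₗ f)) : M ≅ N where
  hom := (⟨e.toLinearMap, h⟩ : M.Hom N)
  inv := (⟨e.symm.toLinearMap, fun f => by
    rw [LinearEquiv.coe_coe, LinearEquiv.symm_apply_eq, h]
    congr 1
    ext c
    simp⟩ : N.Hom M)
  hom_inv_id := Contramod.Hom.ext (LinearMap.ext fun x => e.symm_apply_apply x)
  inv_hom_id := Contramod.Hom.ext (LinearMap.ext fun x => e.apply_symm_apply x)

variable {t : C} (ht : IsFrobeniusElement k t)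

/-- The bijection `f ↦ t¹ f(t²)`. -/
def IsFrobeniusElement.equivL : Module.Dual k C ≃ₗ[k] C :=
  LinearEquiv.ofBijective (hitL.flip t) ht.left

theorem IsFrobeniusElement.hitL_equivL_symm (c : C) : hitL (ht.equivL.symm c) t = c :=
  ht.equivL.apply_symm_apply c

/-- The Nakayama automorphism `ν` of the dual algebra: `t¹ (ν f)(t²) = f(t¹) t²`. -/
def IsFrobeniusElement.nakayama : Module.Dual k C ≃ₗ[k] Module.Dual k C :=
  (LinearEquiv.ofBijective (hitR.flip t) ht.right).trans ht.equivL.symm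

theorem IsFrobeniusElement.hitL_nakayama (f : Module.Dual k C) :
    hitL (ht.nakayama f) t = hitR f t :=
  ht.hitL_equivL_symm _

/-- Compare both sides after acting on `t`. The right action reverses the order of the factors, and
commuting it past the left action restores that order. -/
theorem IsFrobeniusElement.nakayama_dualMul (f g : Module.Dual k C) :
    ht.nakayama (dualMul f g) = dualMul (ht.nakayama f) (ht.nakayama g) := by
  apply ht.left.1
  change hitL _ t = hitL _ t
  rw [ht.hitL_nakayama, hitR_dualMul, ← ht.hitL_nakayama f, ← hitL_hitR, hitL_dualMul,
    ht.hitL_nakayama]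

theorem IsFrobeniusElement.nakayama_counit :
    ht.nakayama (counit (R := k)) = counit (R := k) := by
  apply ht.left.1
  change hitL _ t = hitL _ t
  rw [ht.hitL_nakayama, hitR_counit, hitL_counit]

theorem IsFrobeniusElement.nakayama_symm_dualMul (f g : Module.Dual k C) :
    ht.nakayama.symm (dualMul f g) = dualMul (ht.nakayama.symm f) (ht.nakayama.symm g) := by
  rw [LinearEquiv.symm_apply_eq, ht.nakayama_dualMul, LinearEquiv.apply_symm_apply,
    LinearEquiv.apply_symm_apply]

variable [FiniteDimensional k C]

/-- Evaluation at `t` is a bijection `Hom(C, M)^C → M`. -/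
def IsFrobeniusElement.evalEquiv (M : Comod.{u, v, w} k C) : M.hatSubmodule ≃ₗ[k] M.carrier :=
  LinearEquiv.ofBijective (LinearMap.applyₗ t ∘ₗ M.hatSubmodule.subtype) (by
    constructor
    · rw [injective_iff_map_eq_zero]
      intro φ hφ
      refine Subtype.ext (LinearMap.ext fun c => ?_)
      -- Every `c` is `t¹ f(t²)`, so colinearity gives `φ(c) = f · φ(t)`.
      obtain ⟨f, rfl⟩ := ht.left.2 c
      have h := Comod.mem_hatSubmodule_iff.1 φ.2 f t
      have h0 : φ.1 t = 0 := hφ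
      rw [h0, map_zero] at h
      exact h.symm
    · intro m
      -- The preimage of `m` is `t¹ f(t²) ↦ f · m`; at `t` itself the functional is the counit.
      refine ⟨⟨M.dualAct.flip m ∘ₗ ht.equivL.symm.toLinearMap,
        Comod.mem_hatSubmodule_iff.2 fun f c => ?_⟩, ?_⟩
      · simp only [LinearMap.comp_apply, LinearEquiv.coe_coe, LinearMap.flip_apply,
          ← Comod.dualAct_dualMul]
        refine LinearMap.congr_fun (congrArg M.dualAct (ht.left.1 ?_)) m
        change hitL _ t = hitL _ t
        rw [hitL_dualMul, ht.hitL_equivL_symm, ht.hitL_equivL_symm]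
      · have h1 : ht.equivL.symm t = counit (R := k) := by
          rw [LinearEquiv.symm_apply_eq]
          exact (hitL_counit t).symm
        change M.dualAct (ht.equivL.symm t) m = m
        rw [h1]
        exact LinearMap.congr_fun M.counit_coact m)

theorem IsFrobeniusElement.exists_mem_hatSubmodule (ht : IsFrobeniusElement k t)
    (M : Comod.{u, v, w} k C) (m : M.carrier) : ∃ φ : M.hatSubmodule, φ.1 t = m :=
  (ht.evalEquiv M).surjective m

/-- The contraaction uses the right hit action and colinearity the left one, and `ν` translates
between them at `t`: `φ(f(t¹) t²) = φ(t¹ (ν f)(t²)) = (ν f) · φ(t)`. -/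
theorem IsFrobeniusElement.evalEquiv_dualAct (M : Comod.{u, v, w} k C) (f : Module.Dual k C)
    (φ : M.hatSubmodule) :
    ht.evalEquiv M (M.hatObj.dualAct f φ) = M.dualAct (ht.nakayama f) (ht.evalEquiv M φ) := by
  refine (Comod.hatObj_dualAct M f φ t).trans ?_
  rw [← ht.hitL_nakayama]
  exact (Comod.mem_hatSubmodule_iff.1 φ.2 _ _).symm

theorem IsFrobeniusElement.faithful_hat (ht : IsFrobeniusElement k t) :
    (Comod.hat.{u, v, w} k C).Faithful where
  map_injective {M N} g g' h := by
    refine Comod.Hom.ext (LinearMap.ext fun m => ?_)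
    obtain ⟨φ, rfl⟩ := (ht.evalEquiv M).surjective m
    have h1 := LinearMap.congr_fun (congrArg Contramod.Hom.lin h) φ
    exact LinearMap.congr_fun (congrArg Subtype.val h1) t

theorem IsFrobeniusElement.exists_hatMap_eq (ht : IsFrobeniusElement k t) {M N : Comod.{u, v, w} k C}
    (G : M.hatObj.Hom N.hatObj) : ∃ g : M.Hom N, Comod.hatMap g = G := by
  let G' : M.hatSubmodule →ₗ[k] N.hatSubmodule := G.lin
  let g : M.carrier →ₗ[k] N.carrier :=
    (ht.evalEquiv N).toLinearMap ∘ₗ G' ∘ₗ (ht.evalEquiv M).symm.toLinearMap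
  have hg : ∀ φ, g (ht.evalEquiv M φ) = ht.evalEquiv N (G' φ) := fun φ => by simp [g]
  refine ⟨Comod.Hom.ofDualAct g fun f m => ?_, Contramod.Hom.ext (LinearMap.ext fun φ => ?_)⟩
  · obtain ⟨φ, rfl⟩ := (ht.evalEquiv M).surjective m
    obtain ⟨f, rfl⟩ := ht.nakayama.surjective f
    rw [← ht.evalEquiv_dualAct, hg φ]
    exact ((hg _).trans (congrArg (ht.evalEquiv N) (G.lin_dualAct f φ))).trans
      (ht.evalEquiv_dualAct N f (G' φ))
  -- A colinear map is determined by its value at `t`, and `g ∘ φ` and `G φ` agree there.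
  · exact (ht.evalEquiv N).injective (hg φ)

theorem IsFrobeniusElement.full_hat (ht : IsFrobeniusElement k t) :
    (Comod.hat.{u, v, w} k C).Full where
  map_surjective G := ht.exists_hatMap_eq G

/-- The comodule with `(ν f) · n = α(c ↦ f(c) n)` attached to a contramodule. -/
def IsFrobeniusElement.comod (N : Contramod.{u, v, w} k C) : Comod.{u, v, w} k C :=
  Comod.ofDualAct (N.dualAct ∘ₗ ht.nakayama.symm.toLinearMap)
    (fun f g n => by
      simp only [LinearMap.comp_apply, LinearEquiv.coe_coe, ht.nakayama_symm_dualMul,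
        Contramod.dualAct_dualMul])
    (fun n => by
      have h : ht.nakayama.symm (counit (R := k)) = counit (R := k) := by
        rw [LinearEquiv.symm_apply_eq, ht.nakayama_counit]
      simp only [LinearMap.comp_apply, LinearEquiv.coe_coe, h, Contramod.dualAct_counit])

theorem IsFrobeniusElement.comod_dualAct (N : Contramod.{u, v, w} k C) (f : Module.Dual k C)
    (n : N.carrier) : (ht.comod N).dualAct (ht.nakayama f) n = N.dualAct f n := by
  refine (slice_dualCoact _ _ n).trans ?_
  change N.dualAct (ht.nakayama.symm (ht.nakayama f)) n = _
  rw [LinearEquiv.symm_apply_apply]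

/-- A contramodule `N` is isomorphic to `Hom(C, M)^C`, for the comodule `M` attached to it. -/
def IsFrobeniusElement.hatComodIso (N : Contramod.{u, v, max v w} k C) :
    (ht.comod N).hatObj ≅ N :=
  Contramod.isoOfEquiv (M := (ht.comod N).hatObj) (ht.evalEquiv (ht.comod N)) <|
    Contramod.lin_contra_of_dualAct (M := (ht.comod N).hatObj) (N := N)
      (ht.evalEquiv (ht.comod N)).toLinearMap fun f φ =>
        (ht.evalEquiv_dualAct (ht.comod N) f φ).trans (ht.comod_dualAct N f _)

/-- The functor `M ↦ Hom(C, M)^C` is an equivalence if `C` has a Frobenius element. -/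
theorem IsFrobeniusElement.isEquivalence_hat (ht : IsFrobeniusElement k t) :
    (Comod.hat.{u, v, max v w} k C).IsEquivalence where
  faithful := ht.faithful_hat
  full := ht.full_hat
  essSurj := ⟨fun N => ⟨ht.comod N, ⟨ht.hatComodIso N⟩⟩⟩

end Frobenius

/-! ### Calculus of twisted actions -/

section Sandwich

variable {k : Type u} [Field k] {U A P : Type*} [Ring U] [Algebra k U] [Ring A] [Algebra k A]
  [AddCommGroup P] [Module k P]

/-- `u ⊗ (d ⊗ e) ↦ Ψ(u)(d w e)` -/
def sandwich (Ψ : U →ₗ[k] A →ₗ[k] P) (w : A) : U ⊗[k] (A ⊗[k] A) →ₗ[k] P :=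
  TensorProduct.lift (LinearMap.lcomp k P
    (TensorProduct.lift ((LinearMap.mul k A).compl₂ (LinearMap.mulLeft k w))) ∘ₗ Ψ)

theorem sandwich_tmul (Ψ : U →ₗ[k] A →ₗ[k] P) (w : A) (u : U) (d e : A) :
    sandwich Ψ w (u ⊗ₜ (d ⊗ₜ e)) = Ψ u (d * (w * e)) := rfl

/-- `u ↦ u ⊗ (1 ⊗ 1)` -/
def insM (k : Type u) [Field k] (U A : Type*) [Ring U] [Algebra k U] [Ring A] [Algebra k A] :
    U →ₐ[k] U ⊗[k] (A ⊗[k] A) := Algebra.TensorProduct.includeLeft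

/-- `d ↦ 1 ⊗ (d ⊗ 1)` -/
def insL (k : Type u) [Field k] (U A : Type*) [Ring U] [Algebra k U] [Ring A] [Algebra k A] :
    A →ₐ[k] U ⊗[k] (A ⊗[k] A) :=
  Algebra.TensorProduct.includeRight.comp Algebra.TensorProduct.includeLeft

/-- `e ↦ 1 ⊗ (1 ⊗ e)` -/
def insR (k : Type u) [Field k] (U A : Type*) [Ring U] [Algebra k U] [Ring A] [Algebra k A] :
    A →ₐ[k] U ⊗[k] (A ⊗[k] A) :=
  Algebra.TensorProduct.includeRight.comp Algebra.TensorProduct.includeRight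

theorem insM_apply (u : U) : insM k U A u = u ⊗ₜ[k] ((1 : A) ⊗ₜ[k] (1 : A)) := rfl

theorem insL_apply (d : A) : insL k U A d = (1 : U) ⊗ₜ[k] (d ⊗ₜ[k] (1 : A)) := rfl

theorem insR_apply (e : A) : insR k U A e = (1 : U) ⊗ₜ[k] ((1 : A) ⊗ₜ[k] e) := rfl

end Sandwich

section Twist

variable {k : Type u} [Field k] {H : Type v} [Ring H] [HopfAlgebra k H]
variable {N : Type*} [AddCommGroup N] [Module k N] (act : H →ₐ[k] Module.End k N)
variable {M : Type*} [AddCommGroup M] [Module k M]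

/-- Together with `sandwich`, this turns an iterated Sweedler sum into a linear image of one
convolution product, so that antipode cancellations become identities in a convolution algebra. -/
theorem conv₃_apply {T : Type*} [Ring T] [Algebra k T] (a b c : WithConv (H →ₗ[k] T)) (h : H) :
    (a * (b * c)) h = ∑ i ∈ (ℛ k h).index, ∑ j ∈ (ℛ k ((ℛ k h).right i)).index,
      a ((ℛ k h).left i) * (b ((ℛ k ((ℛ k h).right i)).left j) *
        c ((ℛ k ((ℛ k h).right i)).right j)) := by
  rw [(ℛ k h).convMul_apply]
  refine Finset.sum_congr rfl fun i _ => ?_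
  rw [(ℛ k ((ℛ k h).right i)).convMul_apply, Finset.mul_sum]

theorem aydTwist_one : aydTwist act 1 = 1 := by
  let r : Coalgebra.Repr k (1 : H) Unit := ⟨{()}, fun _ => 1, fun _ => 1, by
    simp [Algebra.TensorProduct.one_def]⟩
  refine TensorProduct.ext' fun n x => ?_
  rw [aydTwist_repr act r (fun _ => r)]
  simp [r]

theorem aydTwist_mul (g h : H) : aydTwist act (g * h) = aydTwist act g * aydTwist act h := by
  refine TensorProduct.ext' fun n x => ?_
  rw [Module.End.mul_apply, aydTwist_repr act (ℛ k h) (fun i => ℛ k _),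
    aydTwist_repr act (mulRepr (ℛ k g) (ℛ k h)) (fun p => mulRepr (ℛ k _) (ℛ k _))]
  simp only [map_sum]
  simp_rw [aydTwist_repr act (ℛ k g) (fun i => ℛ k _)]
  simp only [mulRepr, Finset.sum_product]
  rw [Finset.sum_comm]
  refine Finset.sum_congr rfl fun i _ => ?_
  conv_rhs => rw [Finset.sum_comm]
  refine Finset.sum_congr rfl fun j _ => ?_
  rw [Finset.sum_comm]
  refine Finset.sum_congr rfl fun _ _ => ?_
  refine Finset.sum_congr rfl fun _ _ => ?_
  simp [HopfAlgebra.antipode_mul_antidistrib, mul_assoc]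

/-- The twisted action undoes the conjugation: `h³ n ⊗ h⁴ S(h⁵) x h¹ S(h²) = h n ⊗ x`. -/
theorem sum_aydTwist (h : H) (n : N) (x : H) :
    ∑ i ∈ (ℛ k h).index, ∑ j ∈ (ℛ k ((ℛ k h).right i)).index,
      aydTwist act ((ℛ k ((ℛ k h).right i)).left j) (n ⊗ₜ[k]
        (HopfAlgebra.antipode k ((ℛ k ((ℛ k h).right i)).right j) * (x * (ℛ k h).left i))) =
      act h n ⊗ₜ[k] x := by
  let J := (insM k (Module.End k N) H).comp act
  let D := insL k (Module.End k N) H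
  let E := insR k (Module.End k N) H
  let Ψ : Module.End k N →ₗ[k] H →ₗ[k] N ⊗[k] H := TensorProduct.mk k N H ∘ₗ LinearMap.applyₗ n
  have hterm : ∀ a b c : H, aydTwist act b (n ⊗ₜ[k] (HopfAlgebra.antipode k c * (x * a))) =
      sandwich Ψ x (E a * ((toConv (E.toLinearMap ∘ₗ HopfAlgebra.antipode k) *
        (toConv J.toLinearMap * toConv D.toLinearMap)) b *
          D (HopfAlgebra.antipode k c))) := by
    intro a b c
    rw [aydTwist_repr act (ℛ k b) (fun i => ℛ k _), conv₃_apply]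
    simp only [Finset.mul_sum, Finset.sum_mul, map_sum]
    refine Finset.sum_congr rfl fun i _ => Finset.sum_congr rfl fun j _ => ?_
    simp [J, D, E, insM_apply, insL_apply, insR_apply, sandwich_tmul, Ψ, mul_assoc]
  simp only [hterm, ← map_sum]
  have h1 := conv₃_apply (toConv E.toLinearMap) (toConv (E.toLinearMap ∘ₗ HopfAlgebra.antipode k) *
    (toConv J.toLinearMap * toConv D.toLinearMap)) (toConv (D.toLinearMap ∘ₗ HopfAlgebra.antipode k)) h
  -- The right multipliers `h¹ S(h²)` and the left multipliers `h⁴ S(h⁵)` are adjacent inverse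
  -- pairs; only the action survives.
  have h2 : toConv E.toLinearMap * (toConv (E.toLinearMap ∘ₗ HopfAlgebra.antipode k) *
      (toConv J.toLinearMap * toConv D.toLinearMap) *
        toConv (D.toLinearMap ∘ₗ HopfAlgebra.antipode k)) = toConv J.toLinearMap := by
    rw [mul_assoc, mul_assoc, conv_antipode_right D, mul_one, ← mul_assoc, conv_antipode_right E,
      one_mul]
  rw [h2] at h1
  refine (congrArg (sandwich Ψ x) h1).symm.trans ?_
  change sandwich Ψ x (J h) = _
  simp [J, insM_apply, sandwich_tmul, Ψ]

/-- A map `N → Hom(H, M)` commuting with the actions of `H` gives a map `N ⊗ H → M` commuting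
with the actions of `H`. -/
theorem lift_aydTwist {actM : H →ₐ[k] Module.End k M} (e : N →ₗ[k] H →ₗ[k] M)
    (he : ∀ h n, e (act h n) = twist actM h (e n)) (h : H) (z : N ⊗[k] H) :
    TensorProduct.lift e (aydTwist act h z) = actM h (TensorProduct.lift e z) := by
  suffices hs : TensorProduct.lift e ∘ₗ aydTwist act h = actM h ∘ₗ TensorProduct.lift e from
    LinearMap.congr_fun hs z
  refine TensorProduct.ext' fun n x => ?_
  let J := (insM k (Module.End k M) H).comp actM
  let D := insL k (Module.End k M) H
  let E := insR k (Module.End k M) H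
  let Ψ : Module.End k M →ₗ[k] H →ₗ[k] M := (LinearMap.llcomp k H M M).flip (e n)
  have hterm : ∀ a b c : H, twist actM b (e n) (c * x * HopfAlgebra.antipode k a) =
      sandwich Ψ x (E (HopfAlgebra.antipode k a) * ((toConv E.toLinearMap *
        (toConv J.toLinearMap * toConv (D.toLinearMap ∘ₗ HopfAlgebra.antipode k))) b *
          D c)) := by
    intro a b c
    rw [twist_repr actM (ℛ k b) (fun i => ℛ k _), conv₃_apply]
    simp only [Finset.mul_sum, Finset.sum_mul, map_sum]
    refine Finset.sum_congr rfl fun i _ => Finset.sum_congr rfl fun j _ => ?_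
    simp [J, D, E, insM_apply, insL_apply, insR_apply, sandwich_tmul, Ψ, mul_assoc]
  rw [LinearMap.comp_apply, aydTwist_repr act (ℛ k h) (fun i => ℛ k _)]
  simp only [map_sum, TensorProduct.lift.tmul, he, hterm]
  simp only [← map_sum]
  have h1 := conv₃_apply (toConv (E.toLinearMap ∘ₗ HopfAlgebra.antipode k)) (toConv E.toLinearMap *
    (toConv J.toLinearMap * toConv (D.toLinearMap ∘ₗ HopfAlgebra.antipode k)))
      (toConv D.toLinearMap) h
  -- This is `h³ e(n)(S(h⁴) h⁵ x S(h¹) h²) = h e(n)(x)`.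
  have h2 : toConv (E.toLinearMap ∘ₗ HopfAlgebra.antipode k) * (toConv E.toLinearMap *
      (toConv J.toLinearMap * toConv (D.toLinearMap ∘ₗ HopfAlgebra.antipode k)) *
        toConv D.toLinearMap) = toConv J.toLinearMap := by
    rw [mul_assoc, mul_assoc, conv_antipode_left D, mul_one, ← mul_assoc, conv_antipode_left E,
      one_mul]
  rw [h2] at h1
  refine (congrArg (sandwich Ψ x) h1).symm.trans ?_
  change sandwich Ψ x (J h) = _
  simp [J, insM_apply, sandwich_tmul, Ψ]

end Twist

section Sandwich

variable {k : Type u} [Field k] {U A P : Type*} [Ring U] [Algebra k U] [Ring A] [Algebra k A]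
  [AddCommGroup P] [Module k P]

theorem sandwich_zero (Ψ : U →ₗ[k] A →ₗ[k] P) : sandwich Ψ 0 = 0 := by
  ext u d e
  simp [sandwich_tmul]

theorem sandwich_add (Ψ : U →ₗ[k] A →ₗ[k] P) (w w' : A) :
    sandwich Ψ (w + w') = sandwich Ψ w + sandwich Ψ w' := by
  ext u d e
  simp [sandwich_tmul, add_mul, mul_add]

/-- Factors around the middle term move into the outer slots by `d (c w a) e = (d c) w (a e)`, which
is why `a` multiplies from the left and `c` from the right. -/
theorem sandwich_mul (Ψ : U →ₗ[k] A →ₗ[k] P) (c w a : A) (X : U ⊗[k] (A ⊗[k] A)) :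
    sandwich Ψ (c * (w * a)) X = sandwich Ψ w (insR k U A a * (X * insL k U A c)) := by
  suffices hs : sandwich Ψ (c * (w * a)) = sandwich Ψ w ∘ₗ LinearMap.mulLeft k (insR k U A a) ∘ₗ
      LinearMap.mulRight k (insL k U A c) from LinearMap.congr_fun hs X
  ext u d e
  simp [sandwich_tmul, insR_apply, insL_apply, mul_assoc]

end Sandwich

section Twist

variable {k : Type u} [Field k] {H : Type v} [Ring H] [HopfAlgebra k H]
variable {N : Type*} [AddCommGroup N] [Module k N] (act : H →ₐ[k] Module.End k N)
variable {M : Type*} [AddCommGroup M] [Module k M]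

/-- This puts `f(y¹) y²` into the form of a sandwich of `Δ(y)`, as needed to compare the two sides
of `lift_aydTwist_contra`. -/
theorem tmul_one_mul_comul_mul (f : Module.Dual k H) (y d e : H) {P : Type*} [AddCommGroup P]
    [Module k P] (g : H →ₗ[k] P) :
    TensorProduct.lid k P (TensorProduct.map f g ((1 ⊗ₜ d) * (comul y * (1 ⊗ₜ e)))) =
      g (d * hitR f y * e) := by
  rw [hitR_repr f (ℛ k y), ← (ℛ k y).eq]
  simp [Finset.mul_sum, Finset.sum_mul, mul_assoc]

theorem insL_comul {U : Type*} [Ring U] [Algebra k U] (c : H) :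
    insL k U (H ⊗[k] H) (comul c) =
      (toConv ((insL k U (H ⊗[k] H)).comp Algebra.TensorProduct.includeLeft).toLinearMap *
        toConv ((insL k U (H ⊗[k] H)).comp Algebra.TensorProduct.includeRight).toLinearMap) c := by
  rw [(ℛ k c).convMul_apply, ← (ℛ k c).eq, map_sum]
  refine Finset.sum_congr rfl fun i _ => ?_
  simp [← map_mul]

theorem insR_comul_antipode {U : Type*} [Ring U] [Algebra k U] (a : H) :
    insR k U (H ⊗[k] H) (comul (HopfAlgebra.antipode k a)) =
      (toConv (((insR k U (H ⊗[k] H)).comp Algebra.TensorProduct.includeRight).toLinearMap ∘ₗ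
          HopfAlgebra.antipode k) *
        toConv (((insR k U (H ⊗[k] H)).comp Algebra.TensorProduct.includeLeft).toLinearMap ∘ₗ
          HopfAlgebra.antipode k)) a := by
  rw [(ℛ k a).convMul_apply, comul_antipode_repr (ℛ k a), map_sum]
  refine Finset.sum_congr rfl fun i _ => ?_
  simp [← map_mul]

theorem conv_cancel_inner {T : Type*} [Semiring T] [Algebra k T] (a b c : WithConv (H →ₗ[k] T))
    (D E : H →ₐ[k] T) :
    (a * toConv (E.toLinearMap ∘ₗ HopfAlgebra.antipode k)) *
      ((toConv E.toLinearMap * (b * toConv (D.toLinearMap ∘ₗ HopfAlgebra.antipode k))) *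
        (toConv D.toLinearMap * c)) = a * (b * c) := by
  have hE := conv_antipode_left E
  have hD := conv_antipode_left D
  generalize toConv (E.toLinearMap ∘ₗ HopfAlgebra.antipode k) = eS at *
  generalize toConv (D.toLinearMap ∘ₗ HopfAlgebra.antipode k) = dS at *
  generalize toConv E.toLinearMap = e at *
  generalize toConv D.toLinearMap = d at *
  calc (a * eS) * ((e * (b * dS)) * (d * c))
      = a * ((eS * e) * (b * ((dS * d) * c))) := by simp only [mul_assoc]
    _ = a * (b * c) := by rw [hE, hD, one_mul, one_mul]

/-- For a contramodule `N` with the compatibility of an anti-Yetter-Drinfeld contramodule and a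
morphism `e : N → Hom(H, M)` of contramodules, the maps `α(f ⊗ n) ⊗ y` and `n ⊗ f(y¹) y²` have the
same image in `M` after the twisted action. -/
theorem lift_aydTwist_contra (contra : (H →ₗ[k] N) →ₗ[k] N)
    (hcompat : ∀ h F, act h (contra F) = contra (twist act h F))
    (e : N →ₗ[k] H →ₗ[k] M) (he : ∀ F x, e (contra F) x = TensorProduct.lift (e ∘ₗ F) (comul x))
    (h : H) (f : Module.Dual k H) (n : N) (y : H) :
    TensorProduct.lift e (aydTwist act h (contra (f.smulRight n) ⊗ₜ y)) =
      TensorProduct.lift e (aydTwist act h (n ⊗ₜ hitR f y)) := by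
  let J := (insM k (Module.End k N) (H ⊗[k] H)).comp act
  let D₁ := (insL k (Module.End k N) (H ⊗[k] H)).comp Algebra.TensorProduct.includeLeft
  let D₂ := (insL k (Module.End k N) (H ⊗[k] H)).comp Algebra.TensorProduct.includeRight
  let E₁ := (insR k (Module.End k N) (H ⊗[k] H)).comp Algebra.TensorProduct.includeLeft
  let E₂ := (insR k (Module.End k N) (H ⊗[k] H)).comp Algebra.TensorProduct.includeRight
  obtain ⟨Ψ, hΨ⟩ : ∃ Ψ : Module.End k N →ₗ[k] H ⊗[k] H →ₗ[k] M,
      ∀ u z, Ψ u z = TensorProduct.lid k M (TensorProduct.map f (e (u n)) z) :=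
    ⟨LinearMap.llcomp k (H ⊗[k] H) (k ⊗[k] M) M (TensorProduct.lid k M).toLinearMap ∘ₗ
      TensorProduct.mapBilinear (.id k) H H k M f ∘ₗ e ∘ₗ LinearMap.applyₗ n, fun _ _ => rfl⟩
  have hJ : ∀ a, J a = act a ⊗ₜ ((1 ⊗ₜ 1) ⊗ₜ (1 ⊗ₜ 1)) := fun _ => rfl
  have hD₁ : ∀ a, D₁ a = 1 ⊗ₜ ((a ⊗ₜ 1) ⊗ₜ (1 ⊗ₜ 1)) := fun _ => rfl
  have hD₂ : ∀ a, D₂ a = 1 ⊗ₜ ((1 ⊗ₜ a) ⊗ₜ (1 ⊗ₜ 1)) := fun _ => rfl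
  have hE₁ : ∀ a, E₁ a = 1 ⊗ₜ ((1 ⊗ₜ 1) ⊗ₜ (a ⊗ₜ 1)) := fun _ => rfl
  have hE₂ : ∀ a, E₂ a = 1 ⊗ₜ ((1 ⊗ₜ 1) ⊗ₜ (1 ⊗ₜ a)) := fun _ => rfl
  have hr : ∀ a b c : H, e (act b n) (c * hitR f y * HopfAlgebra.antipode k a) =
      sandwich Ψ (comul y) (E₂ (HopfAlgebra.antipode k a) * (J b * D₂ c)) := by
    intro a b c
    simp only [hJ, hD₂, hE₂, Algebra.TensorProduct.tmul_mul_tmul, one_mul, mul_one,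
      sandwich_tmul, hΨ, tmul_one_mul_comul_mul]
  -- After aYD-compatibility moves `b` inside the contraaction, the twist multiplies only the first
  -- leg, the one fed to `f`.
  have hz : ∀ (b : H) (z : H ⊗[k] H),
      TensorProduct.lift (e ∘ₗ twist act b (f.smulRight n)) z =
        sandwich Ψ z ((toConv E₁.toLinearMap * (toConv J.toLinearMap *
          toConv (D₁.toLinearMap ∘ₗ HopfAlgebra.antipode k))) b) := by
    intro b z
    induction z with
    | zero => rw [sandwich_zero, map_zero, LinearMap.zero_apply]
    | add x y hx hy => rw [sandwich_add, map_add, hx, hy, LinearMap.add_apply]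
    | tmul p q =>
      rw [TensorProduct.lift.tmul, LinearMap.comp_apply,
        twist_repr act (ℛ k b) (fun i => ℛ k _), conv₃_apply]
      simp only [map_sum, LinearMap.sum_apply]
      refine Finset.sum_congr rfl fun i _ => Finset.sum_congr rfl fun j _ => ?_
      simp only [AlgHom.toLinearMap_apply, LinearMap.comp_apply, hJ, hD₁, hE₁,
        Algebra.TensorProduct.tmul_mul_tmul, one_mul, mul_one, sandwich_tmul, hΨ,
        TensorProduct.map_tmul, TensorProduct.lid_tmul, LinearMap.smulRight_apply, map_smul,
        LinearMap.smul_apply]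
  have hl : ∀ a b c : H,
      e (act b (contra (f.smulRight n))) (c * y * HopfAlgebra.antipode k a) =
      sandwich Ψ (comul y) ((toConv (E₂.toLinearMap ∘ₗ HopfAlgebra.antipode k) *
          toConv (E₁.toLinearMap ∘ₗ HopfAlgebra.antipode k)) a *
        ((toConv E₁.toLinearMap * (toConv J.toLinearMap *
          toConv (D₁.toLinearMap ∘ₗ HopfAlgebra.antipode k))) b *
        (toConv D₁.toLinearMap * toConv D₂.toLinearMap) c)) := by
    intro a b c
    rw [hcompat, he, hz, mul_assoc, Bialgebra.comul_mul, Bialgebra.comul_mul, sandwich_mul,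
      insR_comul_antipode, insL_comul]
  rw [aydTwist_repr act (ℛ k h) (fun i => ℛ k _), aydTwist_repr act (ℛ k h) (fun i => ℛ k _)]
  simp only [map_sum, TensorProduct.lift.tmul, hl, hr]
  simp only [← map_sum]
  congr 1
  refine (conv₃_apply _ _ _ h).symm.trans (Eq.trans ?_ (conv₃_apply
    (toConv (E₂.toLinearMap ∘ₗ HopfAlgebra.antipode k)) (toConv J.toLinearMap)
    (toConv D₂.toLinearMap) h))
  -- The multipliers of the first leg cancel in pairs, leaving those of the second leg, which are
  -- the ones on the other side.
  exact congrArg (fun F => F h) (conv_cancel_inner _ _ _ D₁ E₁)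

/-- If `ρ` makes `e n` colinear for all `n`, then the action on `M` induced by the twisted action
on `N ⊗ H` is compatible with `ρ`. -/
theorem coact_lift_aydTwist {actM : H →ₐ[k] Module.End k M} (ρ : M →ₗ[k] M ⊗[k] H)
    (e : N →ₗ[k] H →ₗ[k] M) (hρ : ∀ n x, ρ (e n x) = (e n).rTensor H (comul x))
    (hact : ∀ h z, TensorProduct.lift e (aydTwist act h z) = actM h (TensorProduct.lift e z))
    (h : H) (n : N) (x : H) : ρ (actM h (e n x)) = aydTwist actM h (ρ (e n x)) := by
  let J := (insM k (Module.End k N) (H ⊗[k] H)).comp act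
  let D₁ := (insL k (Module.End k N) (H ⊗[k] H)).comp Algebra.TensorProduct.includeLeft
  let D₂ := (insL k (Module.End k N) (H ⊗[k] H)).comp Algebra.TensorProduct.includeRight
  let E₁ := (insR k (Module.End k N) (H ⊗[k] H)).comp Algebra.TensorProduct.includeLeft
  let E₂ := (insR k (Module.End k N) (H ⊗[k] H)).comp Algebra.TensorProduct.includeRight
  obtain ⟨Ψ, hΨ⟩ : ∃ Ψ : Module.End k N →ₗ[k] H ⊗[k] H →ₗ[k] M ⊗[k] H,
      ∀ u z, Ψ u z = (e (u n)).rTensor H z :=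
    ⟨LinearMap.rTensorHom H ∘ₗ e ∘ₗ LinearMap.applyₗ n, fun _ _ => rfl⟩
  have hJ : ∀ a, J a = act a ⊗ₜ ((1 ⊗ₜ 1) ⊗ₜ (1 ⊗ₜ 1)) := fun _ => rfl
  have hD₁ : ∀ a, D₁ a = 1 ⊗ₜ ((a ⊗ₜ 1) ⊗ₜ (1 ⊗ₜ 1)) := fun _ => rfl
  have hD₂ : ∀ a, D₂ a = 1 ⊗ₜ ((1 ⊗ₜ a) ⊗ₜ (1 ⊗ₜ 1)) := fun _ => rfl
  have hE₁ : ∀ a, E₁ a = 1 ⊗ₜ ((1 ⊗ₜ 1) ⊗ₜ (a ⊗ₜ 1)) := fun _ => rfl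
  have hE₂ : ∀ a, E₂ a = 1 ⊗ₜ ((1 ⊗ₜ 1) ⊗ₜ (1 ⊗ₜ a)) := fun _ => rfl
  have hl : ∀ a b c : H, ρ (e (act b n) (c * x * HopfAlgebra.antipode k a)) =
      sandwich Ψ (comul x) ((toConv (E₂.toLinearMap ∘ₗ HopfAlgebra.antipode k) *
          toConv (E₁.toLinearMap ∘ₗ HopfAlgebra.antipode k)) a *
        (J b * (toConv D₁.toLinearMap * toConv D₂.toLinearMap) c)) := by
    intro a b c
    rw [hρ, mul_assoc, Bialgebra.comul_mul, Bialgebra.comul_mul,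
      ← insR_comul_antipode, ← insL_comul, ← sandwich_mul]
    change _ = Ψ (act b) (1 * (_ * 1))
    rw [one_mul, mul_one, hΨ]
  have hr : ∀ z : H ⊗[k] H, aydTwist actM h ((e n).rTensor H z) =
      sandwich Ψ z ((toConv (E₂.toLinearMap ∘ₗ HopfAlgebra.antipode k) *
        ((toConv (E₁.toLinearMap ∘ₗ HopfAlgebra.antipode k) *
          (toConv J.toLinearMap * toConv D₁.toLinearMap)) * toConv D₂.toLinearMap)) h) := by
    have hin : ∀ (b p : H), actM b (e n p) = TensorProduct.lift e (aydTwist act b (n ⊗ₜ p)) :=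
      fun b p => (hact b (n ⊗ₜ p)).symm
    intro z
    induction z with
    | zero => rw [sandwich_zero, map_zero, map_zero, LinearMap.zero_apply]
    | add x y hx hy => rw [sandwich_add, map_add, map_add, hx, hy, LinearMap.add_apply]
    | tmul p q =>
      rw [LinearMap.rTensor_tmul, aydTwist_repr actM (ℛ k h) (fun i => ℛ k _), conv₃_apply]
      simp only [map_sum]
      refine Finset.sum_congr rfl fun i _ => Finset.sum_congr rfl fun j _ => ?_
      rw [hin, aydTwist_repr act (ℛ k _) (fun i => ℛ k _), conv₃_apply]
      simp only [map_sum, TensorProduct.sum_tmul, Finset.sum_mul, Finset.mul_sum]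
      refine Finset.sum_congr rfl fun _ _ => Finset.sum_congr rfl fun _ _ => ?_
      simp only [AlgHom.toLinearMap_apply, LinearMap.comp_apply, hJ, hD₁, hE₁, hD₂, hE₂,
        Algebra.TensorProduct.tmul_mul_tmul, one_mul, mul_one, sandwich_tmul, hΨ,
        LinearMap.rTensor_tmul, TensorProduct.lift.tmul, mul_assoc]
  rw [hρ, hr, ← TensorProduct.lift.tmul, ← hact, aydTwist_repr act (ℛ k h) (fun i => ℛ k _)]
  simp only [map_sum, TensorProduct.lift.tmul, hl]
  simp only [← map_sum]
  congr 1
  refine (conv₃_apply _ (toConv J.toLinearMap) _ h).symm.trans ?_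
  -- No antipode cancels here: the two convolution products differ only in bracketing.
  simp only [mul_assoc]

end Twist

/-! ### Anti-Yetter-Drinfeld modules and contramodules -/

section AYD

variable {k : Type u} [Field k] {H : Type v} [Ring H] [HopfAlgebra k H]

/-- An isomorphism of anti-Yetter-Drinfeld contramodules from a linear equivalence. -/
def AYDContramod.isoOfEquiv {M N : AYDContramod.{u, v, w} k H} (e : M.carrier ≃ₗ[k] N.carrier)
    (h : ∀ f : H →ₗ[k] M.carrier, e (M.contra f) = N.contra (e.toLinearMap ∘ₗ f))
    (hact : ∀ h m, e (M.act h m) = N.act h (e m)) : M ≅ N where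
  hom := (⟨⟨e.toLinearMap, h⟩, hact⟩ : M.Hom N)
  inv := (⟨⟨e.symm.toLinearMap, fun f => by
    rw [LinearEquiv.coe_coe, LinearEquiv.symm_apply_eq, h]
    congr 1
    ext c
    simp⟩, fun h m => by
      rw [LinearEquiv.coe_coe, LinearEquiv.symm_apply_eq, hact]
      simp⟩ : N.Hom M)
  hom_inv_id := AYDContramod.Hom.ext (LinearMap.ext fun x => e.symm_apply_apply x)
  inv_hom_id := AYDContramod.Hom.ext (LinearMap.ext fun x => e.apply_symm_apply x)

theorem AYDContramod.Hom.isStable_of_surjective {M N : AYDContramod.{u, v, w} k H} (g : M.Hom N)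
    (hg : Function.Surjective g.lin) (hM : AYDContramod.isStable k H M) :
    AYDContramod.isStable k H N := by
  intro n
  obtain ⟨m, rfl⟩ := hg n
  conv_rhs => rw [← hM m, g.comm]
  congr 1
  ext h
  exact (g.act_comm h m).symm

/-- `n ⊗ x ↦ e(n)(x)` -/
def hatEval {N : AYDContramod.{u, v, max v w} k H} {M : Comod.{u, v, w} k H}
    (e : N.carrier ≃ₗ[k] M.hatSubmodule) : N.carrier ⊗[k] H →ₗ[k] M.carrier :=
  TensorProduct.lift (M.hatSubmodule.subtype ∘ₗ e.toLinearMap)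

theorem hatEval_tmul {N : AYDContramod.{u, v, max v w} k H} {M : Comod.{u, v, w} k H}
    (e : N.carrier ≃ₗ[k] M.hatSubmodule) (n : N.carrier) (x : H) : hatEval e (n ⊗ₜ x) = (e n).1 x := rfl

variable {t : H} [FiniteDimensional k H]

/-- Every `m` is `φ(t)` for a colinear `φ`, and by `diagEval_twist_flip` the stability equation of
`φ`, read at `t`, is that of `m`. -/
theorem IsFrobeniusElement.isStable_of_hat (ht : IsFrobeniusElement k t)
    (M : AYDMod.{u, v, w} k H) (hM : AYDContramod.isStable k H ((AYDMod.hat k H).obj M)) :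
    AYDMod.isStable k H M := by
  intro m
  obtain ⟨φ, rfl⟩ := ht.exists_mem_hatSubmodule M.toComod m
  have h1 : diagEval k H M.carrier ((twist M.act).flip φ.1) = φ.1 := congrArg Subtype.val (hM φ)
  have h2 := diagEval_twist_flip M.act φ.1 t
  rw [h1] at h2
  have h3 : M.coact (φ.1 t) = φ.1.rTensor H (comul t) :=
    LinearMap.congr_fun (Comod.mem_hatSubmodule.mp φ.2) t
  rw [h3]
  exact h2.symm

theorem IsFrobeniusElement.faithful_aydHat (ht : IsFrobeniusElement k t) :
    (AYDMod.hat.{u, v, w} k H).Faithful where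
  map_injective {M N} g g' h := by
    have h1 : Comod.hatMap g.toHom = Comod.hatMap g'.toHom :=
      congrArg AYDContramod.Hom.toHom h
    have h2 := ht.faithful_hat.map_injective (X := M.toComod) (Y := N.toComod) h1
    exact AYDMod.Hom.ext (congrArg Comod.Hom.lin h2)

theorem IsFrobeniusElement.full_aydHat (ht : IsFrobeniusElement k t) :
    (AYDMod.hat.{u, v, w} k H).Full where
  map_surjective {M N} G := by
    let G : AYDContramod.Hom M.hatObj N.hatObj := G
    obtain ⟨g, hg⟩ := ht.exists_hatMap_eq G.toHom
    have hGg : ∀ φ : M.toComod.hatSubmodule,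
        Subtype.val (p := (· ∈ N.toComod.hatSubmodule)) (G.lin φ) = g.lin ∘ₗ φ.1 := fun φ =>
      congrArg Subtype.val (LinearMap.congr_fun (congrArg Contramod.Hom.lin hg) φ).symm
    refine ⟨(⟨g, fun h m => ?_⟩ : M.Hom N), AYDContramod.Hom.ext (congrArg Contramod.Hom.lin hg)⟩
    obtain ⟨φ, rfl⟩ := ht.exists_mem_hatSubmodule M.toComod m
    let e := M.toComod.hatSubmodule.subtype
    -- The image of `h(φ ⊗ t)` under `g` after evaluation is computed in two ways: in `M` it gives
    -- `g(h φ(t))`, and in `N`, by `H`-linearity of `G`, it gives `h g(φ(t))`.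
    have h1 := lift_aydTwist M.hatAct (actM := M.act) e (fun _ _ => rfl) h (φ ⊗ₜ t)
    have h2 := lift_aydTwist M.hatAct (actM := N.act) (LinearMap.compRight k g.lin ∘ₗ e)
      (fun h φ => (hGg _).symm.trans ((congrArg Subtype.val (G.act_comm h φ)).trans
        (congrArg (twist N.act h) (hGg φ)))) h (φ ⊗ₜ t)
    have h3 : TensorProduct.lift (LinearMap.compRight k g.lin ∘ₗ e) =
        g.lin ∘ₗ TensorProduct.lift e := TensorProduct.ext' fun _ _ => rfl
    rw [h3, LinearMap.comp_apply, LinearMap.comp_apply, h1] at h2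
    exact h2

/-! ### Descent of the twisted action from `N ⊗ H` to `M` -/

section EssSurj

variable (ht : IsFrobeniusElement k t) {N : AYDContramod.{u, v, max v w} k H}
  {M : Comod.{u, v, w} k H} (e : N.carrier ≃ₗ[k] M.hatSubmodule)

/-- A section of `hatEval`. -/
def IsFrobeniusElement.hatSection : M.carrier →ₗ[k] N.carrier ⊗[k] H :=
  (TensorProduct.mk k N.carrier H).flip t ∘ₗ e.symm.toLinearMap ∘ₗ
    (ht.evalEquiv M).symm.toLinearMap

theorem IsFrobeniusElement.hatSection_evalEquiv (n : N.carrier) :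
    ht.hatSection e (ht.evalEquiv M (e n)) = n ⊗ₜ t := by
  simp [IsFrobeniusElement.hatSection]

theorem IsFrobeniusElement.hatEval_hatSection (m : M.carrier) :
    hatEval e (ht.hatSection e m) = m := by
  obtain ⟨φ, rfl⟩ := (ht.evalEquiv M).surjective m
  obtain ⟨n, rfl⟩ := e.surjective φ
  rw [ht.hatSection_evalEquiv]
  rfl

variable (he : ∀ F, e (N.contra F) = M.hatContra (e.toLinearMap ∘ₗ F))

/-- The twisted action preserves the kernel of evaluation. Writing `x = f(t¹) t²`, the section
replaces `n ⊗ x` by `α(f ⊗ n) ⊗ t`, and `lift_aydTwist_contra` says that this does not change the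
result. -/
theorem IsFrobeniusElement.hatEval_aydTwist_hatSection (ht : IsFrobeniusElement k t)
    (he : ∀ F, e (N.contra F) = M.hatContra (e.toLinearMap ∘ₗ F)) (h : H)
    (z : N.carrier ⊗[k] H) :
    hatEval e (aydTwist N.act h (ht.hatSection e (hatEval e z))) =
      hatEval e (aydTwist N.act h z) := by
  suffices hs : hatEval e ∘ₗ aydTwist N.act h ∘ₗ ht.hatSection e ∘ₗ hatEval e =
      hatEval e ∘ₗ aydTwist N.act h from LinearMap.congr_fun hs z
  refine TensorProduct.ext' fun n x => ?_
  obtain ⟨f, rfl⟩ := ht.right.2 x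
  have h1 : hatEval e (n ⊗ₜ hitR f t) = ht.evalEquiv M (e (N.contra (f.smulRight n))) := by
    have h2 : e.toLinearMap ∘ₗ f.smulRight n = f.smulRight (e n) := by
      ext x
      simp
    rw [he, h2]
    exact (Comod.hatObj_dualAct M f (e n) t).symm
  simp only [LinearMap.comp_apply]
  rw [h1, ht.hatSection_evalEquiv]
  exact lift_aydTwist_contra N.act N.contra N.compat _
    (fun F x => by
      simp only [LinearMap.comp_apply, LinearEquiv.coe_coe, he]
      rfl) h f n t

/-- The action of `H` on `M` induced by the twisted action on `N ⊗ H`. -/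
def IsFrobeniusElement.aydAct : H →ₐ[k] Module.End k M.carrier :=
  AlgHom.ofLinearMap
    (LinearMap.llcomp k M.carrier (N.carrier ⊗[k] H) M.carrier (hatEval e) ∘ₗ
      LinearMap.lcomp k (N.carrier ⊗[k] H) (ht.hatSection e) ∘ₗ aydTwist N.act)
    (LinearMap.ext fun m => by
      change hatEval e (aydTwist N.act 1 (ht.hatSection e m)) = m
      rw [aydTwist_one, Module.End.one_apply, ht.hatEval_hatSection])
    (fun g h => LinearMap.ext fun m => by
      change hatEval e (aydTwist N.act (g * h) (ht.hatSection e m)) =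
        hatEval e (aydTwist N.act g (ht.hatSection e (hatEval e
          (aydTwist N.act h (ht.hatSection e m)))))
      -- The inner section and evaluation can be dropped, so multiplicativity is inherited from the
      -- twisted action.
      rw [ht.hatEval_aydTwist_hatSection e he, aydTwist_mul, Module.End.mul_apply])

theorem IsFrobeniusElement.aydAct_hatEval (h : H) (z : N.carrier ⊗[k] H) :
    ht.aydAct e he h (hatEval e z) = hatEval e (aydTwist N.act h z) :=
  ht.hatEval_aydTwist_hatSection e he h z

/-- Expanding the left side through evaluation gives exactly the sum of `sum_aydTwist`, with value
`h n ⊗ x`. -/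
theorem IsFrobeniusElement.twist_aydAct (h : H) (n : N.carrier) :
    twist (ht.aydAct e he) h (e n).1 = (e (N.act h n)).1 := by
  refine LinearMap.ext fun x => ?_
  rw [twist_repr _ (ℛ k h) (fun i => ℛ k _)]
  simp only [← hatEval_tmul, ht.aydAct_hatEval, ← map_sum, sum_aydTwist]

/-- The anti-Yetter-Drinfeld module with underlying comodule `M` attached to an anti-Yetter-Drinfeld
contramodule with underlying contramodule `Hom(H, M)^H`. -/
def IsFrobeniusElement.aydMod : AYDMod.{u, v, w} k H where
  toComod := M
  act := ht.aydAct e he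
  compat h m := by
    obtain ⟨φ, rfl⟩ := (ht.evalEquiv M).surjective m
    obtain ⟨n, rfl⟩ := e.surjective φ
    exact coact_lift_aydTwist N.act M.coact (M.hatSubmodule.subtype ∘ₗ e.toLinearMap)
      (fun n x => LinearMap.congr_fun (Comod.mem_hatSubmodule.mp (e n).2) x)
      (fun h z => (ht.aydAct_hatEval e he h z).symm) h n t

/-- The anti-Yetter-Drinfeld contramodule `N` is isomorphic to `Hom(H, M)^H`. -/
def IsFrobeniusElement.hatAydModIso : N ≅ (ht.aydMod e he).hatObj :=
  AYDContramod.isoOfEquiv (N := (ht.aydMod e he).hatObj) e he fun h n =>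
    Subtype.ext (ht.twist_aydAct e he h n).symm

end EssSurj

/-- The comodule equivalence supplies the underlying comodule; the descended action then makes the
same linear bijection an isomorphism of aYD-contramodules. -/
theorem IsFrobeniusElement.exists_hatObj_iso (ht : IsFrobeniusElement k t)
    (N : AYDContramod.{u, v, max v w} k H) :
    ∃ M : AYDMod.{u, v, max v w} k H, Nonempty ((AYDMod.hat k H).obj M ≅ N) := by
  let e := (ht.evalEquiv (ht.comod N.toContramod)).symm
  have he : ∀ F, e (N.contra F) =
      (ht.comod N.toContramod).hatContra (e.toLinearMap ∘ₗ F) := fun F =>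
    (ht.hatComodIso N.toContramod).inv.comm F
  exact ⟨ht.aydMod (N := N) e he, ⟨(ht.hatAydModIso (N := N) e he).symm⟩⟩

theorem IsFrobeniusElement.isEquivalence_aydHat (ht : IsFrobeniusElement k t) :
    (AYDMod.hat.{u, v, max v w} k H).IsEquivalence where
  faithful := ht.faithful_aydHat
  full := ht.full_aydHat
  essSurj := ⟨fun N => ht.exists_hatObj_iso N⟩

theorem IsFrobeniusElement.isEquivalence_saydHat (ht : IsFrobeniusElement k t) :
    (SAYDMod.hat.{u, v, max v w} k H).IsEquivalence := by
  have := ht.faithful_aydHat (k := k) (H := H)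
  have := ht.full_aydHat (k := k) (H := H)
  refine { faithful := ?_, full := ?_, essSurj := ⟨fun N => ?_⟩ }
  · exact inferInstanceAs (ObjectProperty.lift _ _ _).Faithful
  · exact inferInstanceAs (ObjectProperty.lift _ _ _).Full
  · obtain ⟨M, ⟨i⟩⟩ := ht.exists_hatObj_iso N.obj
    have hi : Function.Surjective (AYDContramod.Hom.toHom i.inv).lin := fun x =>
      ⟨(AYDContramod.Hom.toHom i.hom).lin x, LinearMap.congr_fun
        (congrArg (fun g : M.hatObj.Hom M.hatObj => g.lin) i.hom_inv_id) x⟩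
    -- Stability passes from `N` to the isomorphic contramodule of `M`, and from there to `M`, so
    -- the preimage found among all aYD-modules is already stable.
    exact ⟨⟨M, ht.isStable_of_hat M (AYDContramod.Hom.isStable_of_surjective i.inv hi N.property)⟩,
      ⟨ObjectProperty.isoMk _ i⟩⟩

end AYD

end HopfCorr

end

theorem mainTheorem8 (k : Type u) [Field k] [CharZero k] (H : Type v) [Ring H] [HopfAlgebra k H]
    [FiniteDimensional k H] (hS : Function.Bijective (HopfAlgebra.antipode k (A := H))) :
    (HopfCorr.Comod.hat.{u, v, max v w} k H).IsEquivalence ∧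
      (HopfCorr.AYDMod.hat.{u, v, max v w} k H).IsEquivalence ∧
      (HopfCorr.SAYDMod.hat.{u, v, max v w} k H).IsEquivalence := by
  obtain ⟨t, ht⟩ := HopfCorr.exists_isFrobeniusElement k H
  exact ⟨ht.isEquivalence_hat, ht.isEquivalence_aydHat, ht.isEquivalence_saydHat⟩
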